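/- Let $n,d\ge 1$ and let $\mathcal G$ be an undirected connected graph on the agents $\{1,\dots,n\}$. Let $W=[W_{ij}]\in\mathbb R^{n\times n}$ be doubly stochastic with $W_{ii}>0$ for all $i$ and, for $i\ne j$, $W_{ij}>0$ if and only if $\{i,j\}$ is an edge of $\mathcal G$. Put $\rho=\|W-n^{-1}\mathbf 1_n\mathbf 1_n^\top\|$ (spectral norm); one has $\rho<1$. Let $f_1,\dots,f_n:\mathbb R^d\to\mathbb R$ be continuously differentiable with $\|\nabla f_i(x)-\nabla f_i(y)\|\le L\|x-y\|$ for all $x,y$ ($L>0$) and with $f_i^*=\inf_x f_i(x)>-\infty$. Let $f=\frac1n\sum_{i=1}^n f_i$ be $\mu$-gradient dominated for some $\mu>0$: $f$ has a global minimizer, with minimum value $f^*$, and $2\mu(f(x)-f^*)\le\|\nabla f(x)\|^2$ for all $x$. Put $\Delta=f^*-\frac1n\sum_{i=1}^n f_i^*$. Let $x^i(0)\in\mathbb R^d$ be arbitrary (deterministic) initial points, let $z^i(t)$ ($t\ge1$, $1\le i\le n$) be mutually independent random vectors, each uniformly distributed on the unit sphere of $\mathbb R^d$, and for $t\ge 1$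 let $$g^i(t)=d\,\frac{f_i(x^i(t-1)+u_tz^i(t))-f_i(x^i(t-1)-u_tz^i(t))}{2u_t}\,z^i(t),\qquad x^i(t)=\sum_{j=1}^n W_{ij}\bigl(x^j(t-1)-\eta_t g^j(t)\bigr).$$ Write $\bar x(t)=\frac1n\sum_{i=1}^n x^i(t)$. Suppose that for all $t\ge1$ $$\eta_t=\frac{2\alpha_\eta}{\mu(t+t_0)},\qquad 0<u_t\le\frac{\alpha_u}{\sqrt{t+t_0}},$$ where $\alpha_\eta>1$, $\alpha_u>0$ and $t_0$ is a real number with $$t_0\ge\frac{2\alpha_\eta L}{\mu(1-\rho^2)}\left(\frac{32Ld}{3\mu}+9\rho\right)-1 .$$ Then, as $t\to\infty$ (all the expectations below being finite), $$\mathbb E\bigl[f(\bar x(t))-f^*\bigr]\le\left(\frac{32\alpha_\eta^2L^2\Delta}{\mu^2}+\frac{6\alpha_\eta\alpha_u^2L^2}{\mu}\right)\frac dt+o(t^{-1}),$$ $$\frac1n\sum_{i=1}^n\mathbb E\bigl[\|x^i(t)-\bar x(t)\|^2\bigr]\le\frac{32\alpha_\eta^2\rho^2L\Delta}{\mu^2(1-\rho^2)}\left(\frac{4d}{3}+\frac{6\rho^2}{1-\rho^2}\right)\frac1{t^2}+o(t^{-2}).$$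 -/

import Mathlib

open MeasureTheory ProbabilityTheory Filter Asymptotics

/-- The Euclidean space `ℝ^d`, with its `ℓ²` norm. -/
abbrev Euc (d : ℕ) : Type := EuclideanSpace ℝ (Fin d)

/-- `f` is `L`-smooth: continuously differentiable with `L`-Lipschitz gradient. -/
def LSmooth {d : ℕ} (L : ℝ) (f : Euc d → ℝ) : Prop :=
  ContDiff ℝ 1 f ∧ ∀ x y : Euc d, ‖gradient f x - gradient f y‖ ≤ L * ‖x - y‖

/-- `f` is `μ`-gradient dominated: differentiable, with a global minimizer `xstar` and
`2 μ (f x - f xstar) ≤ ‖∇ f x‖²` for all `x`. -/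
def GradDominated {d : ℕ} (μ : ℝ) (f : Euc d → ℝ) : Prop :=
  Differentiable ℝ f ∧ ∃ xstar : Euc d, (∀ x, f xstar ≤ f x) ∧
    ∀ x, 2 * μ * (f x - f xstar) ≤ ‖gradient f x‖ ^ 2

/-- The global objective `f = (1/n) ∑ i, f_i`. -/
noncomputable def globalObj {n d : ℕ} (f : Fin n → Euc d → ℝ) (x : Euc d) : ℝ :=
  (1 / (n : ℝ)) * ∑ i, f i x

/-- The average `x̄ = (1/n) ∑ i, x^i` of the agents' local copies. -/
noncomputable def agentAvg {n d : ℕ} (x : Fin n → Euc d) : Euc d :=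
  (1 / (n : ℝ)) • ∑ i, x i

/-- `W` is a consensus matrix for the communication graph `G`: doubly stochastic, with positive
diagonal, and off the diagonal positive exactly at the edges of `G`. -/
structure IsConsensusMatrix {n : ℕ} (G : SimpleGraph (Fin n))
    (W : Matrix (Fin n) (Fin n) ℝ) : Prop where
  doubly_stochastic : W ∈ doublyStochastic ℝ (Fin n)
  diag_pos : ∀ i, 0 < W i i
  offdiag_pos_iff : ∀ i j, i ≠ j → (0 < W i j ↔ G.Adj i j)

/-- `ρ = ‖W - n⁻¹ 1 1ᵀ‖` in the `ℓ²` operator norm. -/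
noncomputable def netRho {n : ℕ} (W : Matrix (Fin n) (Fin n) ℝ) : ℝ :=
  ‖Matrix.toEuclideanCLM (n := Fin n) (𝕜 := ℝ) (W - Matrix.of fun _ _ => 1 / (n : ℝ))‖

/-- The uniform distribution on the unit sphere of `ℝ^d`: the normalized surface measure, as a
measure on `ℝ^d`. -/
noncomputable def uniformSphere (d : ℕ) : Measure (Euc d) :=
  Measure.map Subtype.val
    (((volume : Measure (Euc d)).toSphere Set.univ)⁻¹ • (volume : Measure (Euc d)).toSphere)

/-- The two-point gradient estimator `d ⋅ (f (x + u z) - f (x - u z)) / (2 u) ⋅ z`. -/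
noncomputable def twoPointEst {d : ℕ} (f : Euc d → ℝ) (x : Euc d) (u : ℝ) (z : Euc d) : Euc d :=
  ((d : ℝ) * ((f (x + u • z) - f (x - u • z)) / (2 * u))) • z

/-- The distributed zero-order algorithm, for step sizes `η 1, η 2, …`, smoothing radii
`u 1, u 2, …`, initial points `x0` and directions `z t i` (`t ≥ 1`):
`x^i(t) = ∑ j, W i j (x^j(t-1) - η_t g^j(t))` with
`g^j(t) = twoPointEst f_j (x^j(t-1)) u_t (z^j(t))`. -/
noncomputable def zoIter {n d : ℕ} (W : Matrix (Fin n) (Fin n) ℝ) (f : Fin n → Euc d → ℝ)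
    (η u : ℕ → ℝ) (x0 : Fin n → Euc d) (z : ℕ → Fin n → Euc d) : ℕ → Fin n → Euc d
  | 0 => x0
  | t + 1 => fun i => ∑ j, W i j •
      (zoIter W f η u x0 z t j -
        η (t + 1) • twoPointEst (f j) (zoIter W f η u x0 z t j) (u (t + 1)) (z (t + 1) j))

/-- `Δ = f* - (1/n) ∑ i, f_i*`, where the stars denote infima over `ℝ^d`. -/
noncomputable def optGap {n d : ℕ} (f : Fin n → Euc d → ℝ) : ℝ :=
  (⨅ x, globalObj f x) - (1 / (n : ℝ)) * ∑ i, ⨅ x, f i x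

/-!
On the unit sphere the two-point estimator is `g = d (⟨∇f x, z⟩ + e) z` with `|e| ≤ L u / 2`, by the
second-order Taylor bound. Every estimate therefore reduces to quadratic forms in `z`, whose means
follow from the single identity `E ⟨a, z⟩⟨b, z⟩ = ⟨a, b⟩ / d`
(`integral_uniformSphere_mul`, `integral_inner_mul_inner`); the error `e` is split off by Young's
inequality before averaging, which costs only `d L² u² / 4` per unit step and makes the smoothed
functions and the divergence theorem unnecessary. In particular the estimator satisfies
`‖g‖² ≤ (4/3) d² ⟨∇f x, z⟩² + d² L² u²`.

Let `δ = E[f(x̄) - f*]` and let `v` be the mean squared distance to the average. Since `W` is doubly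
stochastic, `x̄` moves by `-η ḡ`; the descent lemma, gradient domination and
`(1/n) ∑ ‖∇f_i(x^i)‖² ≤ 4 L (f(x̄) - f* + Δ) + 2 L² (1/n) ∑ ‖x^i - x̄‖²` give
`δ' ≤ (1 - η μ + O(η²)) δ + O(η) v + (8/3) L² d η² Δ + η d L² u² / 4 + O(η² u²)`.
Connectivity makes `ρ < 1` (`netRho_lt_one`), and half of the contraction `1 - ρ²` pays for the
cross term between `x^i - x̄` and `g^i`, so that
`v' ≤ ((1 + ρ²)/2 + O(η²)) v + ((4/3) ρ² d + 4 ρ⁴/(1 - ρ²)) η² (4 L Δ + O(δ)) + O(η² u²)`.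

With `η = 2 α / (μ s)`, `u² ≤ αu² / s` and `s = t + t₀`, the coupled recursion is solved
asymptotically (`eventually_le_of_coupled_recursion`): `δ + v = O(1/s)` first, then a geometric
recursion yields the rate of `v`, and Chung's lemma with constant `2 α > 1` yields the rate of `δ`.
The constants obtained are at most the stated ones.

All expectations are finite because the directions lie on the unit sphere almost surely, so that
each iterate takes values in a compact set almost surely.
-/

/-! ### Smooth functions and the two-point estimator -/

lemma LSmooth.hasGradientAt {d : ℕ} {L : ℝ} {f : Euc d → ℝ} (h : LSmooth L f) (x : Euc d) :
    HasGradientAt f (gradient f x) x :=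
  ((h.1.differentiable one_ne_zero) x).hasGradientAt

lemma LSmooth.continuous_gradient {d : ℕ} {L : ℝ} {f : Euc d → ℝ} (h : LSmooth L f) :
    Continuous (gradient f) := by
  refine (LipschitzWith.of_dist_le_mul (K := L.toNNReal) fun x y => ?_).continuous
  rw [dist_eq_norm, dist_eq_norm]
  exact (h.2 x y).trans (mul_le_mul_of_nonneg_right (Real.le_coe_toNNReal L) (norm_nonneg _))

/-- The quadratic Taylor bound (descent lemma) for functions with Lipschitz gradient. -/
lemma LSmooth.abs_sub_sub_inner_le {d : ℕ} {L : ℝ} {f : Euc d → ℝ} (h : LSmooth L f)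
    (x v : Euc d) :
    |f (x + v) - f x - inner ℝ (gradient f x) v| ≤ L / 2 * ‖v‖ ^ 2 := by
  have hg : ∀ s : ℝ, HasDerivAt (fun s : ℝ => f (x + s • v) - f x - s * inner ℝ (gradient f x) v)
      (inner ℝ (gradient f (x + s • v) - gradient f x) v) s := by
    intro s
    have h1 : HasDerivAt (fun s : ℝ => x + s • v) v s := by
      simpa using ((hasDerivAt_id s).smul_const v).const_add x
    have h2 := (h.hasGradientAt (x + s • v)).hasFDerivAt.comp_hasDerivAt s h1
    have h3 := (h2.sub_const (f x)).sub ((hasDerivAt_id s).mul_const (inner ℝ (gradient f x) v))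
    refine h3.congr_deriv ?_
    simp [inner_sub_left]
  have hB : ∀ s : ℝ, HasDerivAt (fun s : ℝ => L / 2 * ‖v‖ ^ 2 * s ^ 2) (L * ‖v‖ ^ 2 * s) s := by
    intro s
    refine ((hasDerivAt_pow 2 s).const_mul (L / 2 * ‖v‖ ^ 2)).congr_deriv ?_
    simp only [Nat.cast_ofNat, Nat.add_one_sub_one, pow_one]
    ring
  have key := image_norm_le_of_norm_deriv_right_le_deriv_boundary (a := 0) (b := 1)
    (f := fun s : ℝ => f (x + s • v) - f x - s * inner ℝ (gradient f x) v)
    (fun s _ => (hg s).continuousAt.continuousWithinAt)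
    (fun s _ => (hg s).hasDerivWithinAt) (by simp) hB ?_
    (Set.right_mem_Icc.2 zero_le_one)
  · simpa using key
  · intro s hs
    calc ‖inner ℝ (gradient f (x + s • v) - gradient f x) v‖
        ≤ ‖gradient f (x + s • v) - gradient f x‖ * ‖v‖ := norm_inner_le_norm _ _
      _ ≤ (L * ‖x + s • v - x‖) * ‖v‖ :=
          mul_le_mul_of_nonneg_right (h.2 _ _) (norm_nonneg _)
      _ = L * ‖v‖ ^ 2 * s := by
          rw [add_sub_cancel_left, norm_smul, Real.norm_eq_abs, abs_of_nonneg hs.1]; ring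

lemma LSmooth.norm_gradient_sq_le {d : ℕ} {L : ℝ} {f : Euc d → ℝ} (h : LSmooth L f) (hL : 0 < L)
    (hb : BddBelow (Set.range f)) (x : Euc d) :
    ‖gradient f x‖ ^ 2 ≤ 2 * L * (f x - ⨅ y, f y) := by
  have h1 := (abs_le.1 (h.abs_sub_sub_inner_le x (-(1 / L) • gradient f x))).2
  have h2 := ciInf_le hb (x + -(1 / L) • gradient f x)
  rw [inner_smul_right, real_inner_self_eq_norm_sq, norm_smul, mul_pow, Real.norm_eq_abs, sq_abs]
    at h1
  have h3 : L / 2 * ((-(1 / L)) ^ 2 * ‖gradient f x‖ ^ 2) = 1 / L * ‖gradient f x‖ ^ 2 / 2 := by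
    field_simp
  have h4 : 1 / L * ‖gradient f x‖ ^ 2 / 2 ≤ f x - ⨅ y, f y := by linarith
  have h5 := mul_le_mul_of_nonneg_left h4 (by positivity : 0 ≤ 2 * L)
  calc ‖gradient f x‖ ^ 2 = 2 * L * (1 / L * ‖gradient f x‖ ^ 2 / 2) := by field_simp
    _ ≤ _ := h5

lemma gradient_globalObj {n d : ℕ} {L : ℝ} {f : Fin n → Euc d → ℝ} (h : ∀ i, LSmooth L (f i))
    (x : Euc d) : gradient (globalObj f) x = (1 / (n : ℝ)) • ∑ i, gradient (f i) x := by
  apply HasGradientAt.gradient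
  rw [hasGradientAt_iff_hasFDerivAt]
  rw [map_smul, map_sum]
  exact (HasFDerivAt.fun_sum (u := Finset.univ)
    fun i _ => ((h i).hasGradientAt x).hasFDerivAt).const_mul (1 / (n : ℝ))

lemma LSmooth.globalObj {n d : ℕ} {L : ℝ} {f : Fin n → Euc d → ℝ} (hn : 0 < n)
    (h : ∀ i, LSmooth L (f i)) : LSmooth L (globalObj f) := by
  have hn' : (0 : ℝ) < n := by exact_mod_cast hn
  refine ⟨?_, fun x y => ?_⟩
  · exact contDiff_const.mul (ContDiff.sum fun i _ => (h i).1)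
  · rw [gradient_globalObj h, gradient_globalObj h, ← smul_sub, ← Finset.sum_sub_distrib, norm_smul,
      Real.norm_eq_abs, abs_of_pos (by positivity)]
    calc 1 / (n : ℝ) * ‖∑ i, (gradient (f i) x - gradient (f i) y)‖
        ≤ 1 / (n : ℝ) * ∑ _i : Fin n, L * ‖x - y‖ := by
          gcongr
          exact norm_sum_le_of_le _ fun i _ => (h i).2 x y
      _ = L * ‖x - y‖ := by
          rw [Finset.sum_const, Finset.card_univ, Fintype.card_fin, nsmul_eq_mul]; field_simp

/-- On the unit sphere the finite difference quotient is the directional derivative up to an error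
`L u / 2`: the second-order Taylor remainders of `f (x ± u z)` are at most `L u² / 2` each. -/
lemma LSmooth.exists_twoPointEst_eq {d : ℕ} {L : ℝ} {f : Euc d → ℝ} (h : LSmooth L f)
    {u : ℝ} (hu : 0 < u) (x : Euc d) {z : Euc d} (hz : ‖z‖ = 1) :
    ∃ e : ℝ, e ^ 2 ≤ L ^ 2 * u ^ 2 / 4 ∧
      twoPointEst f x u z = ((d : ℝ) * (inner ℝ (gradient f x) z + e)) • z := by
  refine ⟨(f (x + u • z) - f (x - u • z)) / (2 * u) - inner ℝ (gradient f x) z, ?_, ?_⟩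
  · have h1 := abs_le.1 (h.abs_sub_sub_inner_le x (u • z))
    have h2 := abs_le.1 (h.abs_sub_sub_inner_le x (-(u • z)))
    rw [norm_neg, inner_neg_right, ← sub_eq_add_neg] at h2
    rw [inner_smul_right, norm_smul, hz, Real.norm_eq_abs, mul_one, sq_abs] at h1 h2
    have h3 : (f (x + u • z) - f (x - u • z)) / (2 * u) - inner ℝ (gradient f x) z =
        (f (x + u • z) - f (x - u • z) - 2 * (u * inner ℝ (gradient f x) z)) / (2 * u) := by
      field_simp
    rw [h3, show L ^ 2 * u ^ 2 / 4 = (L * u / 2) ^ 2 by ring]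
    apply sq_le_sq'
    · rw [le_div_iff₀ (by positivity)]; nlinarith
    · rw [div_le_iff₀ (by positivity)]; nlinarith
  · simp [twoPointEst]

/-! ### Second moments of the uniform distribution on the sphere -/

open scoped Pointwise in
lemma uniformSphere_apply {d : ℕ} {s : Set (Euc d)} (hs : MeasurableSet s) :
    uniformSphere d s = ((volume : Measure (Euc d)).toSphere Set.univ)⁻¹ *
      (d * volume (Set.Ioo (0 : ℝ) 1 • (s ∩ Metric.sphere (0 : Euc d) 1))) := by
  have hm : MeasurableSet ((Subtype.val : Metric.sphere (0 : Euc d) 1 → Euc d) ⁻¹' s) :=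
    measurable_subtype_coe hs
  rw [uniformSphere, Measure.map_apply measurable_subtype_coe hs, Measure.smul_apply,
    Measure.toSphere_apply' _ hm, Subtype.image_preimage_coe, Set.inter_comm]
  simp

open scoped Pointwise in
/-- The uniform distribution on the sphere is invariant under linear isometries. -/
lemma map_uniformSphere {d : ℕ} (A : Euc d ≃ₗᵢ[ℝ] Euc d) :
    (uniformSphere d).map A = uniformSphere d := by
  ext s hs
  rw [Measure.map_apply A.continuous.measurable hs, uniformSphere_apply hs,
    uniformSphere_apply (A.continuous.measurable hs)]
  have hset : Set.Ioo (0 : ℝ) 1 • (A ⁻¹' s ∩ Metric.sphere (0 : Euc d) 1) =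
      A ⁻¹' (Set.Ioo (0 : ℝ) 1 • (s ∩ Metric.sphere (0 : Euc d) 1)) := by
    ext y
    simp only [Set.mem_smul, Set.mem_preimage, Set.mem_inter_iff, mem_sphere_zero_iff_norm]
    constructor
    · rintro ⟨r, hr, z, ⟨hz, hz1⟩, rfl⟩
      exact ⟨r, hr, A z, ⟨hz, by simpa using hz1⟩, by simp⟩
    · rintro ⟨r, hr, z, ⟨hz, hz1⟩, h⟩
      refine ⟨r, hr, A.symm z, ⟨by simpa using hz, by simpa using hz1⟩, ?_⟩
      apply A.injective
      simp [h]
  rw [hset]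
  congr 2
  exact MeasurePreserving.measure_preimage_equiv (f := A.toMeasurableEquiv) A.measurePreserving _

lemma uniformSphere_univ {d : ℕ} (hd : 0 < d) : uniformSphere d Set.univ = 1 := by
  have : Nonempty (Fin d) := ⟨⟨0, hd⟩⟩
  rw [uniformSphere, Measure.map_apply measurable_subtype_coe .univ, Measure.smul_apply,
    Set.preimage_univ, smul_eq_mul]
  refine ENNReal.inv_mul_cancel ?_ (measure_ne_top _ _)
  rw [Measure.measure_univ_ne_zero]
  exact Measure.toSphere_ne_zero _

lemma ae_uniformSphere_norm_eq_one (d : ℕ) : ∀ᵐ z ∂(uniformSphere d), ‖z‖ = 1 := by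
  rw [uniformSphere, ae_map_iff measurable_subtype_coe.aemeasurable
    (measurableSet_eq_fun measurable_norm measurable_const)]
  exact Eventually.of_forall fun z => by simp

lemma integrable_uniformSphere_of_continuous {d : ℕ} (hd : 0 < d) {φ : Euc d → ℝ}
    (hφ : Continuous φ) : Integrable φ (uniformSphere d) := by
  have : IsProbabilityMeasure (uniformSphere d) := ⟨uniformSphere_univ hd⟩
  obtain ⟨C, hC⟩ := (isCompact_sphere (0 : Euc d) 1).exists_bound_of_continuousOn hφ.continuousOn
  refine Integrable.of_bound hφ.aestronglyMeasurable C ?_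
  filter_upwards [ae_uniformSphere_norm_eq_one d] with z hz
  exact hC z (by simpa using hz)

lemma integral_uniformSphere_comp {d : ℕ} (A : Euc d ≃ₗᵢ[ℝ] Euc d) (φ : Euc d → ℝ) :
    ∫ z, φ (A z) ∂(uniformSphere d) = ∫ z, φ z ∂(uniformSphere d) := by
  conv_rhs => rw [← map_uniformSphere A]
  exact (integral_map_equiv A.toMeasurableEquiv φ).symm

/-- The uniform distribution on the sphere has covariance `I / d`: off-diagonal moments change sign
under a reflection in a coordinate, and the diagonal ones agree by symmetry and sum to `1`. -/
lemma integral_uniformSphere_mul {d : ℕ} (hd : 0 < d) (k l : Fin d) :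
    ∫ z, z k * z l ∂(uniformSphere d) = if k = l then 1 / (d : ℝ) else 0 := by
  classical
  split_ifs with hkl
  · subst hkl
    have hsym : ∀ l : Fin d, ∫ z, z l * z l ∂(uniformSphere d) =
        ∫ z, z k * z k ∂(uniformSphere d) := by
      intro l
      rw [← integral_uniformSphere_comp
        (LinearIsometryEquiv.piLpCongrLeft 2 ℝ ℝ (Equiv.swap k l)) fun z => z k * z k]
      simp [LinearIsometryEquiv.piLpCongrLeft_apply]
    have hsum : ∑ l : Fin d, ∫ z, z l * z l ∂(uniformSphere d) = 1 := by
      rw [← integral_finsetSum _ fun l _ =>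
        integrable_uniformSphere_of_continuous hd (by fun_prop)]
      have : (fun z : Euc d => ∑ l, z l * z l) =ᵐ[uniformSphere d] fun _ => (1 : ℝ) := by
        filter_upwards [ae_uniformSphere_norm_eq_one d] with z hz
        have := EuclideanSpace.real_norm_sq_eq z
        rw [hz] at this
        simp only [← sq]
        rw [← this]; norm_num
      rw [integral_congr_ae this]
      simp [Measure.real, uniformSphere_univ hd]
    rw [Finset.sum_congr rfl fun l _ => hsym l] at hsum
    rw [Finset.sum_const, Finset.card_univ, Fintype.card_fin, nsmul_eq_mul] at hsum
    have : (d : ℝ) ≠ 0 := by exact_mod_cast hd.ne'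
    rw [eq_div_iff this, mul_comm, hsum]
  · have h := integral_uniformSphere_comp (LinearIsometryEquiv.piLpCongrRight 2
      fun i : Fin d => if i = k then LinearIsometryEquiv.neg ℝ (E := ℝ)
        else LinearIsometryEquiv.refl ℝ ℝ) fun z => z k * z l
    simp only [LinearIsometryEquiv.piLpCongrRight_apply, if_true, Ne.symm hkl, if_false,
      LinearIsometryEquiv.coe_neg, LinearIsometryEquiv.coe_refl, id, neg_mul, integral_neg] at h
    linarith

/-! ### Averages and the contraction of the consensus step -/

/-- The mean squared distance `(1/n) ∑ i, ‖x^i - x̄‖²` of the local copies to their average. -/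
noncomputable def consensusErr {n d : ℕ} (x : Fin n → Euc d) : ℝ :=
  (1 / (n : ℝ)) * ∑ i, ‖x i - agentAvg x‖ ^ 2

lemma consensusErr_nonneg {n d : ℕ} (x : Fin n → Euc d) : 0 ≤ consensusErr x := by
  unfold consensusErr; positivity

lemma sum_sub_agentAvg {n d : ℕ} (hn : 0 < n) (x : Fin n → Euc d) :
    ∑ i, (x i - agentAvg x) = 0 := by
  have : (n : ℝ) ≠ 0 := by exact_mod_cast hn.ne'
  rw [Finset.sum_sub_distrib, Finset.sum_const, Finset.card_univ, Fintype.card_fin, agentAvg,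
    ← Nat.cast_smul_eq_nsmul ℝ, smul_smul, mul_one_div_cancel this, one_smul, sub_self]

/-- The average minimizes the sum of squared distances. -/
lemma consensusErr_le {n d : ℕ} (hn : 0 < n) (x : Fin n → Euc d) (c : Euc d) :
    consensusErr x ≤ (1 / (n : ℝ)) * ∑ i, ‖x i - c‖ ^ 2 := by
  unfold consensusErr
  refine mul_le_mul_of_nonneg_left ?_ (by positivity)
  have h : ∀ i, ‖x i - c‖ ^ 2 = ‖x i - agentAvg x‖ ^ 2 +
      2 * inner ℝ (x i - agentAvg x) (agentAvg x - c) + ‖agentAvg x - c‖ ^ 2 := by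
    intro i
    rw [← norm_add_sq_real, sub_add_sub_cancel]
  rw [Finset.sum_congr rfl fun i _ => h i, Finset.sum_add_distrib, Finset.sum_add_distrib,
    ← Finset.mul_sum, ← sum_inner, sum_sub_agentAvg hn, inner_zero_left, mul_zero, add_zero]
  exact le_add_of_nonneg_right (Finset.sum_nonneg fun _ _ => sq_nonneg _)

lemma norm_agentAvg_sq_le {n d : ℕ} (x : Fin n → Euc d) :
    ‖agentAvg x‖ ^ 2 ≤ (1 / (n : ℝ)) * ∑ i, ‖x i‖ ^ 2 := by
  rcases Nat.eq_zero_or_pos n with rfl | hn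
  · simp [agentAvg]
  have hn' : (0 : ℝ) < n := by exact_mod_cast hn
  have h1 : ‖∑ i, x i‖ ^ 2 ≤ n * ∑ i, ‖x i‖ ^ 2 := by
    calc ‖∑ i, x i‖ ^ 2 ≤ (∑ i, ‖x i‖) ^ 2 := by gcongr; exact norm_sum_le _ _
      _ ≤ n * ∑ i, ‖x i‖ ^ 2 := by
        simpa using sq_sum_le_card_mul_sum_sq (s := Finset.univ) (f := fun i => ‖x i‖)
  rw [agentAvg, norm_smul, mul_pow, Real.norm_eq_abs, sq_abs]
  calc (1 / (n : ℝ)) ^ 2 * ‖∑ i, x i‖ ^ 2 ≤ (1 / (n : ℝ)) ^ 2 * (n * ∑ i, ‖x i‖ ^ 2) := by gcongr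
    _ = _ := by field_simp

lemma agentAvg_sum_smul {n d : ℕ} {W : Matrix (Fin n) (Fin n) ℝ}
    (hW : W ∈ doublyStochastic ℝ (Fin n)) (y : Fin n → Euc d) :
    agentAvg (fun i => ∑ j, W i j • y j) = agentAvg y := by
  unfold agentAvg
  rw [Finset.sum_comm]
  simp_rw [← Finset.sum_smul, sum_col_of_mem_doublyStochastic hW, one_smul]

/-- A matrix acts on families of vectors with at most its `ℓ²` operator norm, coordinate by
coordinate. -/
lemma sum_norm_sum_smul_sq_le {n d : ℕ} (M : Matrix (Fin n) (Fin n) ℝ) (y : Fin n → Euc d) :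
    ∑ i, ‖∑ j, M i j • y j‖ ^ 2 ≤
      ‖Matrix.toEuclideanCLM (n := Fin n) (𝕜 := ℝ) M‖ ^ 2 * ∑ i, ‖y i‖ ^ 2 := by
  have key : ∀ k : Fin d, ∑ i, (∑ j, M i j • y j) k ^ 2 ≤
      ‖Matrix.toEuclideanCLM (n := Fin n) (𝕜 := ℝ) M‖ ^ 2 * ∑ i, y i k ^ 2 := by
    intro k
    have h := (Matrix.toEuclideanCLM (n := Fin n) (𝕜 := ℝ) M).le_opNorm
      (WithLp.toLp 2 fun j => y j k)
    have h2 := pow_le_pow_left₀ (norm_nonneg _) h 2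
    rw [mul_pow, EuclideanSpace.real_norm_sq_eq, EuclideanSpace.real_norm_sq_eq] at h2
    simpa [Matrix.mulVec, dotProduct] using h2
  simp_rw [EuclideanSpace.real_norm_sq_eq]
  rw [Finset.sum_comm, Finset.sum_comm (f := fun i k => y i k ^ 2), Finset.mul_sum]
  exact Finset.sum_le_sum fun k _ => key k

lemma consensusErr_sum_smul_le {n d : ℕ} (hn : 0 < n) {W : Matrix (Fin n) (Fin n) ℝ}
    (hW : W ∈ doublyStochastic ℝ (Fin n)) (y : Fin n → Euc d) :
    consensusErr (fun i => ∑ j, W i j • y j) ≤ netRho W ^ 2 * consensusErr y := by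
  have h := sum_norm_sum_smul_sq_le (W - Matrix.of fun _ _ => 1 / (n : ℝ))
    fun i => y i - agentAvg y
  have h2 : ∀ i, ∑ j, (W - Matrix.of fun _ _ => 1 / (n : ℝ) : Matrix (Fin n) (Fin n) ℝ) i j •
      (y j - agentAvg y) =
      ∑ j, W i j • y j - agentAvg y := by
    intro i
    simp_rw [Matrix.sub_apply, Matrix.of_apply, sub_smul, Finset.sum_sub_distrib,
      ← Finset.smul_sum, sum_sub_agentAvg hn, smul_zero, sub_zero, smul_sub,
      Finset.sum_sub_distrib, ← Finset.sum_smul, sum_row_of_mem_doublyStochastic hW, one_smul]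
  simp_rw [h2] at h
  unfold consensusErr
  rw [agentAvg_sum_smul hW, mul_left_comm]
  exact mul_le_mul_of_nonneg_left h (by positivity)

/-- The loss of `ℓ²` norm under a doubly stochastic matrix. In particular, if the norm is preserved
then `w j = (W w) i` whenever `W i j > 0`. -/
lemma sum_sq_sub_sum_mulVec_sq {n : ℕ} {W : Matrix (Fin n) (Fin n) ℝ}
    (hW : W ∈ doublyStochastic ℝ (Fin n)) (w : Fin n → ℝ) :
    ∑ j, w j ^ 2 - ∑ i, (W.mulVec w) i ^ 2 =
      ∑ i, ∑ j, W i j * (w j - (W.mulVec w) i) ^ 2 := by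
  have h1 : ∑ j, w j ^ 2 = ∑ i, ∑ j, W i j * w j ^ 2 := by
    rw [Finset.sum_comm]
    simp_rw [← Finset.sum_mul, sum_col_of_mem_doublyStochastic hW, one_mul]
  rw [h1, ← Finset.sum_sub_distrib]
  refine Finset.sum_congr rfl fun i _ => ?_
  have h2 : ∀ j, W i j * (w j - (W.mulVec w) i) ^ 2 =
      W i j * w j ^ 2 - 2 * (W.mulVec w) i * (W i j * w j) + (W.mulVec w) i ^ 2 * W i j := by
    intro j; ring
  rw [Finset.sum_congr rfl fun j _ => h2 j, Finset.sum_add_distrib, Finset.sum_sub_distrib,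
    ← Finset.mul_sum, ← Finset.mul_sum, sum_row_of_mem_doublyStochastic hW]
  have h3 : ∑ j, W i j * w j = (W.mulVec w) i := rfl
  rw [h3]; ring

lemma netRho_nonneg {n : ℕ} (W : Matrix (Fin n) (Fin n) ℝ) : 0 ≤ netRho W := norm_nonneg _

/-- Connectivity of the graph makes the consensus step a strict contraction: a vector whose norm is
not decreased by `W - n⁻¹ 1 1ᵀ` is constant along edges after centering, hence zero. -/
lemma netRho_lt_one {n : ℕ} {G : SimpleGraph (Fin n)} (hG : G.Connected)
    {W : Matrix (Fin n) (Fin n) ℝ} (hW : IsConsensusMatrix G W) : netRho W < 1 := by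
  have hne := hG.nonempty
  have hn : 0 < n := Fin.pos_iff_nonempty.2 hne
  have hn' : (n : ℝ) ≠ 0 := by exact_mod_cast hn.ne'
  have hds := hW.doubly_stochastic
  set A := Matrix.toEuclideanCLM (n := Fin n) (𝕜 := ℝ) (W - Matrix.of fun _ _ => 1 / (n : ℝ))
    with hA
  have hlt : ∀ v : EuclideanSpace ℝ (Fin n), v ≠ 0 → ‖A v‖ < ‖v‖ := by
    intro v hv
    by_contra hcon
    push Not at hcon
    set m : ℝ := (1 / (n : ℝ)) * ∑ j, v j with hm
    set w : Fin n → ℝ := fun j => v j - m with hw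
    have hw0 : ∑ j, w j = 0 := by
      simp only [hw, Finset.sum_sub_distrib, Finset.sum_const, Finset.card_univ, Fintype.card_fin,
        nsmul_eq_mul, hm]
      field_simp
      simp
    have hAw : ∀ i, A v i = (W.mulVec w) i := by
      intro i
      have e1 : A v i = ∑ j, (W i j - 1 / (n : ℝ)) * v j := by
        rfl
      have e2 : (W.mulVec w) i = ∑ j, W i j * (v j - m) := rfl
      rw [e1, e2]
      simp_rw [sub_mul, mul_sub, Finset.sum_sub_distrib, ← Finset.sum_mul,
        sum_row_of_mem_doublyStochastic hds, ← Finset.mul_sum, one_mul]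
      rfl
    have hvw : ∑ j, w j ^ 2 ≤ ∑ j, v j ^ 2 := by
      have e : ∀ j, v j ^ 2 = w j ^ 2 + 2 * m * w j + m ^ 2 := by intro j; simp only [hw]; ring
      rw [Finset.sum_congr rfl fun j _ => e j, Finset.sum_add_distrib, Finset.sum_add_distrib,
        ← Finset.mul_sum, hw0, mul_zero, add_zero]
      exact le_add_of_nonneg_right (Finset.sum_nonneg fun _ _ => sq_nonneg _)
    have hcon2 := pow_le_pow_left₀ (norm_nonneg _) hcon 2
    rw [EuclideanSpace.real_norm_sq_eq, EuclideanSpace.real_norm_sq_eq] at hcon2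
    simp_rw [hAw] at hcon2
    have hid := sum_sq_sub_sum_mulVec_sq hds w
    have hterm : ∀ i j, 0 ≤ W i j * (w j - (W.mulVec w) i) ^ 2 := fun i j =>
      mul_nonneg (hds.1 i j) (sq_nonneg _)
    have hzero : ∑ i, ∑ j, W i j * (w j - (W.mulVec w) i) ^ 2 = 0 :=
      le_antisymm (by linarith) (Finset.sum_nonneg fun i _ =>
        Finset.sum_nonneg fun j _ => hterm i j)
    have hall : ∀ i j, 0 < W i j → w j = (W.mulVec w) i := by
      intro i j hij
      have h1 := (Finset.sum_eq_zero_iff_of_nonneg fun i _ =>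
        Finset.sum_nonneg fun j _ => hterm i j).1 hzero i (Finset.mem_univ _)
      have h2 := (Finset.sum_eq_zero_iff_of_nonneg fun j _ => hterm i j).1 h1 j (Finset.mem_univ _)
      have h3 := (mul_eq_zero.1 h2).resolve_left hij.ne'
      exact sub_eq_zero.1 (pow_eq_zero_iff two_ne_zero |>.1 h3)
    have hadj : ∀ i j, G.Adj i j → w i = w j := by
      intro i j hij
      rw [hall i i (hW.diag_pos i), hall i j ((hW.offdiag_pos_iff i j hij.ne).2 hij)]
    have hconst : ∀ i j, w i = w j := by
      intro i j
      obtain ⟨p⟩ := hG.preconnected i j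
      induction p with
      | nil => rfl
      | cons h _ ih => exact (hadj _ _ h).trans ih
    have hwz : ∀ i, w i = 0 := by
      intro i
      rw [Finset.sum_congr rfl fun j _ => hconst j i, Finset.sum_const, Finset.card_univ,
        Fintype.card_fin, nsmul_eq_mul] at hw0
      exact (mul_eq_zero.1 hw0).resolve_left hn'
    apply hv
    have hvz : ∑ j, v j ^ 2 ≤ 0 := by
      refine hcon2.trans (le_of_eq ?_)
      refine Finset.sum_eq_zero fun i _ => ?_
      rw [← hall i i (hW.diag_pos i), hwz i]; norm_num
    rw [← EuclideanSpace.real_norm_sq_eq] at hvz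
    exact norm_eq_zero.1 (pow_eq_zero_iff two_ne_zero |>.1 (le_antisymm hvz (sq_nonneg _)))
  obtain ⟨v, hv, hmax⟩ := (isCompact_sphere (0 : EuclideanSpace ℝ (Fin n)) 1).exists_isMaxOn
    (NormedSpace.sphere_nonempty.2 zero_le_one) (A.continuous.norm.continuousOn)
  have hv1 : ‖v‖ = 1 := by simpa using hv
  have hle : ‖A‖ ≤ ‖A v‖ := ContinuousLinearMap.opNorm_le_of_unit_norm (norm_nonneg _)
    fun y hy => hmax (by simpa using hy)
  calc netRho W = ‖A‖ := rfl
    _ ≤ ‖A v‖ := hle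
    _ < ‖v‖ := hlt v (by rintro rfl; simp at hv1)
    _ = 1 := hv1

/-! ### Recursive inequalities for real sequences -/

/-- Averaging with a divergent total weight: if eventually `w (t+1) ≤ (1 - λ t) w t + λ t * β t`
with `∑ λ = ∞` and `β → B`, then `limsup w ≤ B`. -/
lemma eventually_le_of_averaging {w lam β : ℕ → ℝ} {B : ℝ}
    (hlam : ∀ᶠ t in atTop, 0 ≤ lam t ∧ lam t ≤ 1)
    (hsum : Tendsto (fun t => ∑ s ∈ Finset.range t, lam s) atTop atTop)
    (hβ : Tendsto β atTop (nhds B))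
    (hw : ∀ᶠ t in atTop, w (t + 1) ≤ (1 - lam t) * w t + lam t * β t) :
    ∀ ε > 0, ∀ᶠ t in atTop, w t ≤ B + ε := by
  intro ε hε
  have hβ' : ∀ᶠ t in atTop, β t ≤ B + ε / 2 :=
    (hβ.eventually (gt_mem_nhds (by linarith))).mono fun _ h => le_of_lt h
  obtain ⟨T, hT⟩ := eventually_atTop.1 (hlam.and (hβ'.and hw))
  set S : ℕ → ℝ := fun t => ∑ s ∈ Finset.range t, lam s with hS
  have hstep : ∀ t ≥ T, max (w t - (B + ε / 2)) 0 ≤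
      max (w T - (B + ε / 2)) 0 * Real.exp (S T - S t) := by
    intro t ht
    induction t, ht using Nat.le_induction with
    | base => simp
    | succ t ht ih =>
      obtain ⟨⟨h0, h1⟩, h2, h3⟩ := hT t ht
      have e1 : w (t + 1) - (B + ε / 2) ≤ (1 - lam t) * max (w t - (B + ε / 2)) 0 := by
        have := mul_le_mul_of_nonneg_left h2 h0
        have := mul_le_mul_of_nonneg_left (le_max_left (w t - (B + ε / 2)) 0)
          (by linarith : 0 ≤ 1 - lam t)
        linarith
      have e2 : max (w (t + 1) - (B + ε / 2)) 0 ≤ (1 - lam t) * max (w t - (B + ε / 2)) 0 :=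
        max_le e1 (mul_nonneg (by linarith) (le_max_right _ _))
      have e3 : 1 - lam t ≤ Real.exp (-lam t) := by
        have := Real.add_one_le_exp (-lam t); linarith
      have e4 : S T - S (t + 1) = -lam t + (S T - S t) := by
        simp only [hS, Finset.sum_range_succ]; ring
      rw [e4, Real.exp_add]
      calc _ ≤ (1 - lam t) * max (w t - (B + ε / 2)) 0 := e2
        _ ≤ Real.exp (-lam t) * (max (w T - (B + ε / 2)) 0 * Real.exp (S T - S t)) := by
          gcongr
        _ = _ := by ring
  have hlim : Tendsto (fun t => max (w T - (B + ε / 2)) 0 * Real.exp (S T - S t)) atTop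
      (nhds 0) := by
    have h1 : Tendsto (fun t => S T - S t) atTop atBot := by
      simpa [sub_eq_add_neg] using
        tendsto_atBot_add_const_left atTop (S T) (tendsto_neg_atTop_atBot.comp hsum)
    simpa using (Real.tendsto_exp_atBot.comp h1).const_mul (max (w T - (B + ε / 2)) 0)
  filter_upwards [hlim.eventually (gt_mem_nhds (half_pos hε)), eventually_ge_atTop T] with t h1 h2
  have := (le_max_left _ _).trans (hstep t h2)
  linarith

lemma tendsto_inv_natCast_add (b : ℝ) :
    Tendsto (fun t : ℕ => 1 / ((t : ℝ) + b)) atTop (nhds 0) := by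
  simp only [one_div]
  exact tendsto_inv_atTop_zero.comp
    (tendsto_atTop_add_const_right _ _ tendsto_natCast_atTop_atTop)

/-- Chung's lemma: `a (t+1) ≤ (1 - c/s) a t + κ t / s²` with `s = t + b`, `c > 1` and `κ → K` gives
`limsup s a ≤ K / (c - 1)`. -/
lemma eventually_mul_le_of_recursion {a κ : ℕ → ℝ} {b c K : ℝ} (hb : 0 < b) (hc : 1 < c)
    (hκ : Tendsto κ atTop (nhds K))
    (ha : ∀ᶠ t : ℕ in atTop, a (t + 1) ≤ (1 - c / (t + b)) * a t + κ t / (t + b) ^ 2) :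
    ∀ ε > 0, ∀ᶠ t : ℕ in atTop, a t * (t + b) ≤ K / (c - 1) + ε := by
  have hs : ∀ t : ℕ, 0 < (t : ℝ) + b := fun t => by positivity
  have hinv := tendsto_inv_natCast_add b
  -- In terms of `a t * (t + b)` the averaging weight is `1 - (1 - c/s) (s + 1)/s`.
  set lam : ℕ → ℝ := fun t => (c - 1 + c * (1 / (t + b))) * (1 / (t + b)) with hlam
  set β : ℕ → ℝ := fun t => κ t * (1 + 1 / (t + b)) / (c - 1 + c * (1 / (t + b))) with hβ
  have hpos : ∀ t : ℕ, 0 < c - 1 + c * (1 / ((t : ℝ) + b)) := fun t => by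
    have := hs t
    have : 0 < c * (1 / ((t : ℝ) + b)) := by positivity
    linarith
  refine eventually_le_of_averaging (lam := lam) (β := β) ?_ ?_ ?_ ?_
  · have h : Tendsto lam atTop (nhds ((c - 1 + c * 0) * 0)) :=
      ((hinv.const_mul c).const_add (c - 1)).mul hinv
    rw [mul_zero] at h
    filter_upwards [h.eventually (gt_mem_nhds one_pos)] with t ht
    exact ⟨mul_nonneg (hpos t).le (one_div_pos.2 (hs t)).le, ht.le⟩
  · have hnn : ∀ t, 0 ≤ lam t := fun t => mul_nonneg (hpos t).le (one_div_pos.2 (hs t)).le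
    refine (not_summable_iff_tendsto_nat_atTop_of_nonneg hnn).1 fun hsum => ?_
    have h1 : Summable fun t : ℕ => (c - 1) * (1 / ((t : ℝ) + b)) := by
      refine Summable.of_nonneg_of_le (fun t => mul_nonneg (by linarith)
        (one_div_pos.2 (hs t)).le) (fun t => ?_) hsum
      refine mul_le_mul_of_nonneg_right ?_ (one_div_pos.2 (hs t)).le
      have := hs t
      have : 0 < c * (1 / ((t : ℝ) + b)) := by positivity
      linarith
    have h2 : Summable fun t : ℕ => 1 / |(t : ℝ) + b| ^ (1 : ℝ) := by
      refine ((summable_mul_left_iff (by linarith : c - 1 ≠ 0)).1 h1).congr fun t => ?_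
      rw [Real.rpow_one, abs_of_pos (hs t)]
    exact absurd ((Real.summable_one_div_nat_add_rpow b 1).1 h2) (lt_irrefl _)
  · have h := (hκ.mul (hinv.const_add 1)).div ((hinv.const_mul c).const_add (c - 1))
      (by simp; linarith)
    simp only [add_zero, mul_zero, mul_one] at h
    exact h
  · filter_upwards [ha] with t ht
    have hst := hs t
    have hp := hpos t
    have h1 := mul_le_mul_of_nonneg_right ht (by positivity : 0 ≤ (t : ℝ) + b + 1)
    have e : lam t * β t = κ t * (1 + 1 / (t + b)) * (1 / (t + b)) := by
      have gen : ∀ A r N : ℝ, A ≠ 0 → A * r * (N / A) = N * r := by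
        intro A r N hA
        field_simp
      exact gen _ _ _ hp.ne'
    have e2 : ((1 - c / (t + b)) * a t + κ t / (t + b) ^ 2) * ((t : ℝ) + b + 1) =
        (1 - lam t) * (a t * (t + b)) + lam t * β t := by
      rw [e]; simp only [hlam]; field_simp; ring
    rw [← e2]
    push_cast
    calc _ = a (t + 1) * ((t : ℝ) + b + 1) := by ring
      _ ≤ _ := h1

lemma eventually_mul_sq_le_of_recursion {v κ : ℕ → ℝ} {b q K : ℝ} (hb : 0 < b) (hq0 : 0 ≤ q)
    (hq : q < 1) (hκ : Tendsto κ atTop (nhds K))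
    (hv : ∀ᶠ t : ℕ in atTop, v (t + 1) ≤ q * v t + κ t / (t + b) ^ 2) :
    ∀ ε > 0, ∀ᶠ t : ℕ in atTop, v t * (t + b) ^ 2 ≤ K / (1 - q) + ε := by
  have hs : ∀ t : ℕ, 0 < (t : ℝ) + b := fun t => by positivity
  have hinv := tendsto_inv_natCast_add b
  set lam : ℕ → ℝ := fun t => 1 - q * (1 + 1 / (t + b)) ^ 2 with hlam
  set β : ℕ → ℝ := fun t => κ t * (1 + 1 / (t + b)) ^ 2 / lam t with hβ
  have hlim : Tendsto lam atTop (nhds (1 - q)) := by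
    have h := (((hinv.const_add 1).pow 2).const_mul q).const_sub 1
    simp only [add_zero, one_pow, mul_one] at h
    exact h
  have hpos : ∀ᶠ t in atTop, (1 - q) / 2 < lam t := hlim.eventually (lt_mem_nhds (by linarith))
  refine eventually_le_of_averaging (lam := lam) (β := β) ?_ ?_ ?_ ?_
  · filter_upwards [hpos] with t ht
    refine ⟨by linarith, ?_⟩
    have : 0 ≤ q * (1 + 1 / ((t : ℝ) + b)) ^ 2 := by positivity
    simp only [hlam]; linarith
  · obtain ⟨T, hT⟩ := eventually_atTop.1 hpos
    have hge : ∀ t ≥ T, ∑ s ∈ Finset.range T, lam s + (1 - q) / 2 * ((t : ℝ) - T) ≤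
        ∑ s ∈ Finset.range t, lam s := by
      intro t ht
      induction t, ht using Nat.le_induction with
      | base => simp
      | succ t ht ih =>
        rw [Finset.sum_range_succ]
        have := hT t ht
        push_cast
        linarith
    refine tendsto_atTop_mono' _ (eventually_atTop.2 ⟨T, hge⟩) ?_
    refine tendsto_atTop_add_const_left _ _ (Tendsto.const_mul_atTop (by linarith) ?_)
    simpa [sub_eq_add_neg] using
      tendsto_atTop_add_const_right atTop (-(T : ℝ)) tendsto_natCast_atTop_atTop
  · have h := (hκ.mul ((hinv.const_add 1).pow 2)).div hlim (by linarith)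
    simp only [add_zero, one_pow, mul_one] at h
    exact h
  · filter_upwards [hv, hpos] with t ht hp
    have hst := hs t
    have hp' : lam t ≠ 0 := by linarith
    have h1 := mul_le_mul_of_nonneg_right ht (by positivity : 0 ≤ ((t : ℝ) + b + 1) ^ 2)
    have e : lam t * β t = κ t * (1 + 1 / (t + b)) ^ 2 := by
      simp only [hβ]; field_simp
    have e2 : (q * v t + κ t / (t + b) ^ 2) * ((t : ℝ) + b + 1) ^ 2 =
        (1 - lam t) * (v t * (t + b) ^ 2) + lam t * β t := by
      rw [e]; simp only [hlam]; field_simp; ring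
    rw [← e2]
    push_cast
    calc _ = v (t + 1) * ((t : ℝ) + b + 1) ^ 2 := by ring
      _ ≤ _ := h1

/-- Asymptotics of the coupled recursion for an optimality gap `δ` and a consensus error `v`. The
sum `δ + v` is first seen to be `O(1/s)`; this makes all cross terms negligible. -/
lemma eventually_le_of_coupled_recursion {δ v : ℕ → ℝ} {b c q C K₁ K₂ : ℝ} (hb : 0 < b)
    (hc : 1 < c) (hq0 : 0 ≤ q) (hq : q < 1) (hC : 0 ≤ C) (hδ0 : ∀ t, 0 ≤ δ t) (hv0 : ∀ t, 0 ≤ v t)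
    (hδ : ∀ t : ℕ, δ (t + 1) ≤ (1 - c / (t + b) + C / (t + b) ^ 2) * δ t +
      (C / (t + b) + C / (t + b) ^ 2) * v t + K₁ / (t + b) ^ 2 + C / (t + b) ^ 3)
    (hv : ∀ t : ℕ, v (t + 1) ≤ (q + C / (t + b) ^ 2) * v t + C / (t + b) ^ 2 * δ t +
      K₂ / (t + b) ^ 2 + C / (t + b) ^ 3) :
    (∀ ε > 0, ∀ᶠ t : ℕ in atTop, δ t * (t + b) ≤ K₁ / (c - 1) + ε) ∧
    (∀ ε > 0, ∀ᶠ t : ℕ in atTop, v t * (t + b) ^ 2 ≤ K₂ / (1 - q) + ε) := by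
  have hs : ∀ t : ℕ, 0 < (t : ℝ) + b := fun t => by positivity
  have hinv := tendsto_inv_natCast_add b
  -- A crude `O(1/s)` bound on the sum.
  obtain ⟨D, hD⟩ : ∃ D : ℝ, ∀ᶠ t : ℕ in atTop, (δ t + v t) * (t + b) ≤ D := by
    set c' := (1 + c) / 2 with hc'
    have hκ : Tendsto (fun t : ℕ => K₁ + K₂ + 2 * C * (1 / ((t : ℝ) + b))) atTop
        (nhds (K₁ + K₂)) := by
      simpa using (hinv.const_mul (2 * C)).const_add (K₁ + K₂)
    refine ⟨_, eventually_mul_le_of_recursion (a := fun t => δ t + v t) hb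
      (by linarith : 1 < c') hκ ?_ 1 one_pos⟩
    have e1 : ∀ᶠ t : ℕ in atTop, 2 * C * (1 / ((t : ℝ) + b)) < (c - 1) / 2 := by
      have := hinv.const_mul (2 * C)
      rw [mul_zero] at this
      exact this.eventually (gt_mem_nhds (by linarith))
    have e2 : ∀ᶠ t : ℕ in atTop,
        (C + c' + 2 * C * (1 / ((t : ℝ) + b))) * (1 / ((t : ℝ) + b)) < 1 - q := by
      have := ((hinv.const_mul (2 * C)).const_add (C + c')).mul hinv
      rw [mul_zero] at this
      exact this.eventually (gt_mem_nhds (by linarith))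
    filter_upwards [e1, e2] with t h1 h2
    have hst := hs t
    have hi : 0 < 1 / ((t : ℝ) + b) := one_div_pos.2 hst
    have a1 := hδ t
    have a2 := hv t
    set r := 1 / ((t : ℝ) + b) with hr
    have r1 : ∀ y : ℝ, y / (t + b) = y * r := fun y => by rw [hr, one_div, div_eq_mul_inv]
    have r2 : ∀ y : ℝ, y / (t + b) ^ 2 = y * r ^ 2 := fun y => by
      rw [hr, one_div, inv_pow, div_eq_mul_inv]
    have r3 : ∀ y : ℝ, y / (t + b) ^ 3 = y * r ^ 3 := fun y => by
      rw [hr, one_div, inv_pow, div_eq_mul_inv]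
    simp only [r1, r2, r3] at a1 a2 ⊢
    have m1 := mul_le_mul_of_nonneg_right h1.le (mul_nonneg hi.le (hδ0 t))
    have m2 := mul_le_mul_of_nonneg_right h2.le (hv0 t)
    have e3 : c' = 1 / 2 + c / 2 := by rw [hc']; ring
    rw [e3] at m2 ⊢
    linarith
  have hD1 : ∀ᶠ t : ℕ in atTop, δ t ≤ D * (1 / (t + b)) ∧ v t ≤ D * (1 / (t + b)) := by
    filter_upwards [hD] with t ht
    have hst := hs t
    have := (le_div_iff₀ hst).2 ht
    rw [mul_one_div]
    exact ⟨by linarith [hv0 t], by linarith [hδ0 t]⟩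
  have hv2 : ∀ ε > 0, ∀ᶠ t : ℕ in atTop, v t * (t + b) ^ 2 ≤ K₂ / (1 - q) + ε := by
    have hκ : Tendsto (fun t : ℕ => K₂ + (2 * C * D + C) * (1 / ((t : ℝ) + b))) atTop
        (nhds K₂) := by
      simpa using (hinv.const_mul (2 * C * D + C)).const_add K₂
    refine eventually_mul_sq_le_of_recursion hb hq0 hq hκ ?_
    filter_upwards [hD1] with t ⟨h1, h2⟩
    have hst := hs t
    have a2 := hv t
    have hC2 : 0 ≤ C / ((t : ℝ) + b) ^ 2 := by positivity
    have m1 := mul_le_mul_of_nonneg_left h1 hC2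
    have m2 := mul_le_mul_of_nonneg_left h2 hC2
    have e : (K₂ + (2 * C * D + C) * (1 / ((t : ℝ) + b))) / (t + b) ^ 2 =
      K₂ / (t + b) ^ 2 + 2 * (C / (t + b) ^ 2 * (D * (1 / (t + b)))) + C / (t + b) ^ 3 := by
      field_simp; ring
    rw [e]
    linarith
  refine ⟨?_, hv2⟩
  set E := K₂ / (1 - q) + 1 with hE
  have hκ : Tendsto (fun t : ℕ => K₁ + (C * D + C * E + C) * (1 / ((t : ℝ) + b)) +
      C * E * (1 / ((t : ℝ) + b)) ^ 2) atTop (nhds K₁) := by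
    simpa using ((hinv.const_mul (C * D + C * E + C)).const_add K₁).add
      ((hinv.pow 2).const_mul (C * E))
  refine eventually_mul_le_of_recursion hb hc hκ ?_
  filter_upwards [hD1, hv2 1 one_pos] with t ⟨h1, _⟩ h2
  have hst := hs t
  have a1 := hδ t
  have h3 : v t ≤ E / (t + b) ^ 2 := (le_div_iff₀ (by positivity)).2 h2
  have m1 := mul_le_mul_of_nonneg_left h1 (by positivity : 0 ≤ C / ((t : ℝ) + b) ^ 2)
  have m2 := mul_le_mul_of_nonneg_left h3
    (by positivity : 0 ≤ C / ((t : ℝ) + b) + C / ((t : ℝ) + b) ^ 2)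
  have e : (K₁ + (C * D + C * E + C) * (1 / ((t : ℝ) + b)) +
      C * E * (1 / ((t : ℝ) + b)) ^ 2) / (t + b) ^ 2 =
      K₁ / (t + b) ^ 2 + C / (t + b) ^ 2 * (D * (1 / (t + b))) +
      (C / (t + b) + C / (t + b) ^ 2) * (E / (t + b) ^ 2) + C / (t + b) ^ 3 := by
    field_simp; ring
  rw [e]
  linarith

/-- An asymptotic bound `a ≤ (B + o(1)) p` against a positive sequence `p`, as a remainder. -/
lemma exists_isLittleO_remainder {a p : ℕ → ℝ} {B : ℝ} (hp : ∀ᶠ t in atTop, 0 ≤ p t)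
    (h : ∀ ε > 0, ∀ᶠ t in atTop, a t ≤ (B + ε) * p t) :
    ∃ r : ℕ → ℝ, r =o[atTop] p ∧ ∀ t, a t ≤ B * p t + r t := by
  refine ⟨fun t => max (a t - B * p t) 0, ?_, fun t => ?_⟩
  · refine isLittleO_iff.2 fun ε hε => ?_
    filter_upwards [hp, h ε hε] with t h1 h2
    rw [Real.norm_of_nonneg (le_max_right _ _), Real.norm_of_nonneg h1]
    exact max_le (by linarith) (by positivity)
  · have := le_max_left (a t - B * p t) 0
    linarith

/-! ### One step of the algorithm, for fixed directions -/

/-- One step of the algorithm, with step size `η`, smoothing radius `u` and directions `z`. -/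
noncomputable def zoStep {n d : ℕ} (W : Matrix (Fin n) (Fin n) ℝ) (f : Fin n → Euc d → ℝ)
    (η u : ℝ) (x z : Fin n → Euc d) : Fin n → Euc d :=
  fun i => ∑ j, W i j • (x j - η • twoPointEst (f j) (x j) u (z j))

/-- The average over the agents of the quadratic form
`c₁ ⟨a, z⟩⟨b, z⟩ + c₂ ⟨b, z⟩² + c₃ ⟨a, z⟩²`. -/
noncomputable def avgQuad {n d : ℕ} (c₁ c₂ c₃ : ℝ) (a b z : Fin n → Euc d) : ℝ :=
  (1 / (n : ℝ)) * ∑ i, (c₁ * (inner ℝ (a i) (z i) * inner ℝ (b i) (z i)) +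
    c₂ * inner ℝ (b i) (z i) ^ 2 + c₃ * inner ℝ (a i) (z i) ^ 2)

/-- The mean of `avgQuad c₁ c₂ c₃ a b z` over uniformly distributed unit vectors `z i`. -/
noncomputable def avgQuadMean {n d : ℕ} (c₁ c₂ c₃ : ℝ) (a b : Fin n → Euc d) : ℝ :=
  (1 / (n : ℝ)) * ∑ i, (c₁ * inner ℝ (a i) (b i) + c₂ * ‖b i‖ ^ 2 + c₃ * ‖a i‖ ^ 2) / (d : ℝ)

lemma LSmooth.neg_inner_twoPointEst_le {d : ℕ} {L : ℝ} {f : Euc d → ℝ} (hf : LSmooth L f)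
    {u κ : ℝ} (hu : 0 < u) (hκ : 0 < κ) (x h : Euc d) {z : Euc d} (hz : ‖z‖ = 1) :
    -inner ℝ h (twoPointEst f x u z) ≤
      -((d : ℝ) * (inner ℝ (gradient f x) z * inner ℝ h z)) +
        d * (κ / 2 * inner ℝ h z ^ 2 + L ^ 2 * u ^ 2 / (8 * κ)) := by
  obtain ⟨e, he, hg⟩ := hf.exists_twoPointEst_eq hu x hz
  rw [hg, inner_smul_right]
  set p := inner ℝ (gradient f x) z
  set q := inner ℝ h z
  have h1 : -(e * q) ≤ κ / 2 * q ^ 2 + e ^ 2 / (2 * κ) := by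
    have h2 : κ / 2 * q ^ 2 + e ^ 2 / (2 * κ) + e * q = (κ * q + e) ^ 2 / (2 * κ) := by
      field_simp; ring
    have : 0 ≤ (κ * q + e) ^ 2 / (2 * κ) := by positivity
    linarith
  have h3 : e ^ 2 / (2 * κ) ≤ L ^ 2 * u ^ 2 / (8 * κ) := by
    have : L ^ 2 * u ^ 2 / (8 * κ) = (L ^ 2 * u ^ 2 / 4) / (2 * κ) := by
      field_simp; ring
    rw [this]
    gcongr
  have h4 := mul_le_mul_of_nonneg_left (h1.trans (add_le_add_right h3 _))
    (Nat.cast_nonneg (α := ℝ) d)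
  linarith

lemma LSmooth.norm_twoPointEst_sq_le {d : ℕ} {L : ℝ} {f : Euc d → ℝ} (hf : LSmooth L f)
    {u : ℝ} (hu : 0 < u) (x : Euc d) {z : Euc d} (hz : ‖z‖ = 1) :
    ‖twoPointEst f x u z‖ ^ 2 ≤
      4 / 3 * (d : ℝ) ^ 2 * inner ℝ (gradient f x) z ^ 2 + (d : ℝ) ^ 2 * (L ^ 2 * u ^ 2) := by
  obtain ⟨e, he, hg⟩ := hf.exists_twoPointEst_eq hu x hz
  rw [hg, norm_smul, hz, mul_one, Real.norm_eq_abs, sq_abs, mul_pow]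
  set p := inner ℝ (gradient f x) z
  have h1 : (p + e) ^ 2 ≤ 4 / 3 * p ^ 2 + L ^ 2 * u ^ 2 := by
    nlinarith [sq_nonneg (p - 3 * e)]
  have := mul_le_mul_of_nonneg_left h1 (sq_nonneg (d : ℝ))
  linarith

lemma agentAvg_zoStep {n d : ℕ} {W : Matrix (Fin n) (Fin n) ℝ}
    (hW : W ∈ doublyStochastic ℝ (Fin n)) (f : Fin n → Euc d → ℝ) (η u : ℝ)
    (x z : Fin n → Euc d) :
    agentAvg (zoStep W f η u x z) =
      agentAvg x + -(η • agentAvg fun i => twoPointEst (f i) (x i) u (z i)) := by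
  unfold zoStep
  rw [agentAvg_sum_smul hW fun j => x j - η • twoPointEst (f j) (x j) u (z j)]
  simp only [agentAvg, Finset.sum_sub_distrib, ← Finset.smul_sum, smul_sub]
  rw [smul_comm, sub_eq_add_neg]

lemma globalObj_zoStep_le {n d : ℕ} (hn : 0 < n) {W : Matrix (Fin n) (Fin n) ℝ}
    (hW : W ∈ doublyStochastic ℝ (Fin n)) {f : Fin n → Euc d → ℝ} {L : ℝ} (hL : 0 < L)
    (hf : ∀ i, LSmooth L (f i)) {η u : ℝ} (hη : 0 ≤ η) (hu : 0 < u) (x : Fin n → Euc d)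
    {z : Fin n → Euc d} (hz : ∀ i, ‖z i‖ = 1) :
    globalObj f (agentAvg (zoStep W f η u x z)) ≤ globalObj f (agentAvg x) +
      (η * d * (L ^ 2 * u ^ 2) / 4 + L / 2 * η ^ 2 * (d ^ 2 * (L ^ 2 * u ^ 2))) +
      avgQuad (-(η * d)) (η * d / 4) (2 / 3 * L * η ^ 2 * d ^ 2) (fun i => gradient (f i) (x i))
        (fun _ => gradient (globalObj f) (agentAvg x)) z := by
  have hn' : (n : ℝ) ≠ 0 := by exact_mod_cast hn.ne'
  set h := gradient (globalObj f) (agentAvg x)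
  set g : Fin n → Euc d := fun i => twoPointEst (f i) (x i) u (z i)
  have h1 := (abs_le.1 ((LSmooth.globalObj hn hf).abs_sub_sub_inner_le (agentAvg x)
    (-(η • agentAvg g)))).2
  rw [← agentAvg_zoStep hW, inner_neg_right, inner_smul_right, norm_neg, norm_smul, mul_pow,
    Real.norm_eq_abs, sq_abs] at h1
  have h2 : inner ℝ h (agentAvg g) = (1 / (n : ℝ)) * ∑ i, inner ℝ h (g i) := by
    rw [agentAvg, inner_smul_right, inner_sum]
  have h3 : L / 2 * (η ^ 2 * ‖agentAvg g‖ ^ 2) ≤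
      L / 2 * (η ^ 2 * ((1 / (n : ℝ)) * ∑ i, ‖g i‖ ^ 2)) := by
    gcongr; exact norm_agentAvg_sq_le g
  have h4 : (1 / (n : ℝ)) * ∑ i, (-η * inner ℝ h (g i) + L / 2 * η ^ 2 * ‖g i‖ ^ 2) ≤
      (η * d * (L ^ 2 * u ^ 2) / 4 + L / 2 * η ^ 2 * (d ^ 2 * (L ^ 2 * u ^ 2))) +
      avgQuad (-(η * d)) (η * d / 4) (2 / 3 * L * η ^ 2 * d ^ 2) (fun i => gradient (f i) (x i))
        (fun _ => h) z := by
    have e : ∀ c : ℝ, c = (1 / (n : ℝ)) * ∑ _i : Fin n, c := by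
      intro c
      rw [Finset.sum_const, Finset.card_univ, Fintype.card_fin, nsmul_eq_mul]; field_simp
    rw [avgQuad, e (η * d * (L ^ 2 * u ^ 2) / 4 + L / 2 * η ^ 2 * (d ^ 2 * (L ^ 2 * u ^ 2))),
      ← mul_add, ← Finset.sum_add_distrib]
    refine mul_le_mul_of_nonneg_left (Finset.sum_le_sum fun i _ => ?_) (by positivity)
    have a1 := mul_le_mul_of_nonneg_left
      ((hf i).neg_inner_twoPointEst_le hu (one_half_pos (α := ℝ)) (x i) h (hz i)) hη
    have a2 := mul_le_mul_of_nonneg_left ((hf i).norm_twoPointEst_sq_le hu (x i) (hz i))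
      (by positivity : 0 ≤ L / 2 * η ^ 2)
    have a3 : L ^ 2 * u ^ 2 / (8 * (1 / 2)) = L ^ 2 * u ^ 2 / 4 := by norm_num
    rw [a3] at a1
    linarith
  rw [Finset.sum_add_distrib, ← Finset.mul_sum, ← Finset.mul_sum] at h4
  rw [h2] at h1
  linarith

lemma consensusErr_zoStep_le {n d : ℕ} (hn : 0 < n) {W : Matrix (Fin n) (Fin n) ℝ}
    (hW : W ∈ doublyStochastic ℝ (Fin n)) {f : Fin n → Euc d → ℝ} {L : ℝ}
    (hf : ∀ i, LSmooth L (f i)) {η u κ : ℝ} (hη : 0 ≤ η) (hu : 0 < u) (hκ : 0 < κ)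
    (x : Fin n → Euc d) {z : Fin n → Euc d} (hz : ∀ i, ‖z i‖ = 1) :
    consensusErr (zoStep W f η u x z) ≤ netRho W ^ 2 * (consensusErr x +
      (η * d * (L ^ 2 * u ^ 2) / (4 * κ) + η ^ 2 * (d ^ 2 * (L ^ 2 * u ^ 2))) +
      avgQuad (-(2 * η * d)) (η * d * κ) (4 / 3 * η ^ 2 * d ^ 2) (fun i => gradient (f i) (x i))
        (fun i => x i - agentAvg x) z) := by
  have hn' : (n : ℝ) ≠ 0 := by exact_mod_cast hn.ne'
  refine (consensusErr_sum_smul_le hn hW fun j =>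
    x j - η • twoPointEst (f j) (x j) u (z j)).trans ?_
  refine mul_le_mul_of_nonneg_left ?_ (sq_nonneg _)
  refine (consensusErr_le hn _ (agentAvg x)).trans ?_
  have e : ∀ c : ℝ, c = (1 / (n : ℝ)) * ∑ _i : Fin n, c := by
    intro c
    rw [Finset.sum_const, Finset.card_univ, Fintype.card_fin, nsmul_eq_mul]; field_simp
  rw [avgQuad, consensusErr,
    e (η * d * (L ^ 2 * u ^ 2) / (4 * κ) + η ^ 2 * (d ^ 2 * (L ^ 2 * u ^ 2))),
    ← mul_add, ← mul_add, ← Finset.sum_add_distrib, ← Finset.sum_add_distrib]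
  refine mul_le_mul_of_nonneg_left (Finset.sum_le_sum fun i _ => ?_) (by positivity)
  rw [sub_right_comm, norm_sub_sq_real, inner_smul_right, norm_smul, mul_pow, Real.norm_eq_abs,
    sq_abs]
  have a1 := mul_le_mul_of_nonneg_left
    ((hf i).neg_inner_twoPointEst_le hu hκ (x i) (x i - agentAvg x) (hz i))
    (by positivity : 0 ≤ 2 * η)
  have a2 := mul_le_mul_of_nonneg_left ((hf i).norm_twoPointEst_sq_le hu (x i) (hz i))
    (sq_nonneg η)
  have a3 : 2 * η * (d * (L ^ 2 * u ^ 2 / (8 * κ))) = η * d * (L ^ 2 * u ^ 2) / (4 * κ) := by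
    field_simp; ring
  linarith

/-! ### Bounds on the conditional means -/

lemma avg_norm_gradient_sq_le {n d : ℕ} {f : Fin n → Euc d → ℝ} {L : ℝ} (hL : 0 < L)
    (hf : ∀ i, LSmooth L (f i)) (hb : ∀ i, BddBelow (Set.range (f i))) (x : Fin n → Euc d) :
    (1 / (n : ℝ)) * ∑ i, ‖gradient (f i) (x i)‖ ^ 2 ≤
      4 * L * (globalObj f (agentAvg x) - (⨅ y, globalObj f y) + optGap f) +
        2 * L ^ 2 * consensusErr x := by
  have h : ∀ i, ‖gradient (f i) (x i)‖ ^ 2 ≤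
      4 * L * (f i (agentAvg x) - ⨅ y, f i y) + 2 * L ^ 2 * ‖x i - agentAvg x‖ ^ 2 := by
    intro i
    have h1 := (hf i).norm_gradient_sq_le hL (hb i) (agentAvg x)
    have h2 := pow_le_pow_left₀ (norm_nonneg _) ((hf i).2 (x i) (agentAvg x)) 2
    have h3 : ‖gradient (f i) (x i)‖ ≤
        ‖gradient (f i) (agentAvg x)‖ + ‖gradient (f i) (x i) - gradient (f i) (agentAvg x)‖ := by
      simpa using norm_add_le (gradient (f i) (agentAvg x))
        (gradient (f i) (x i) - gradient (f i) (agentAvg x))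
    have h4 := pow_le_pow_left₀ (norm_nonneg _) h3 2
    have h5 := add_sq_le (a := ‖gradient (f i) (agentAvg x)‖)
      (b := ‖gradient (f i) (x i) - gradient (f i) (agentAvg x)‖)
    rw [mul_pow] at h2
    linarith
  refine (mul_le_mul_of_nonneg_left (Finset.sum_le_sum fun i _ => h i)
    (by positivity : 0 ≤ 1 / (n : ℝ))).trans (le_of_eq ?_)
  rw [Finset.sum_add_distrib, ← Finset.mul_sum, ← Finset.mul_sum, Finset.sum_sub_distrib,
    consensusErr, optGap, globalObj]
  ring

lemma norm_agentAvg_gradient_sub_sq_le {n d : ℕ} {f : Fin n → Euc d → ℝ} {L : ℝ}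
    (hf : ∀ i, LSmooth L (f i)) (x : Fin n → Euc d) :
    ‖agentAvg (fun i => gradient (f i) (x i)) - gradient (globalObj f) (agentAvg x)‖ ^ 2 ≤
      L ^ 2 * consensusErr x := by
  have e : agentAvg (fun i => gradient (f i) (x i)) - gradient (globalObj f) (agentAvg x) =
      agentAvg fun i => gradient (f i) (x i) - gradient (f i) (agentAvg x) := by
    rw [gradient_globalObj hf, agentAvg, ← smul_sub, ← Finset.sum_sub_distrib]; rfl
  rw [e, consensusErr, mul_left_comm, Finset.mul_sum]
  refine (norm_agentAvg_sq_le _).trans (mul_le_mul_of_nonneg_left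
    (Finset.sum_le_sum fun i _ => ?_) (by positivity))
  have h2 := pow_le_pow_left₀ (norm_nonneg _) ((hf i).2 (x i) (agentAvg x)) 2
  rwa [mul_pow] at h2

lemma GradDominated.two_mul_sub_iInf_le {d : ℕ} {μ : ℝ} {f : Euc d → ℝ} (h : GradDominated μ f)
    (x : Euc d) : 2 * μ * (f x - ⨅ y, f y) ≤ ‖gradient f x‖ ^ 2 := by
  obtain ⟨-, xs, hmin, hx⟩ := h
  have : ⨅ y, f y = f xs :=
    le_antisymm (ciInf_le ⟨f xs, by rintro _ ⟨y, rfl⟩; exact hmin y⟩ xs) (le_ciInf hmin)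
  rw [this]; exact hx x

lemma GradDominated.iInf_le {d : ℕ} {μ : ℝ} {f : Euc d → ℝ} (h : GradDominated μ f)
    (x : Euc d) : ⨅ y, f y ≤ f x := by
  obtain ⟨-, xs, hmin, -⟩ := h
  exact ciInf_le ⟨f xs, by rintro _ ⟨y, rfl⟩; exact hmin y⟩ x

lemma optGap_nonneg {n d : ℕ} {f : Fin n → Euc d → ℝ} (hb : ∀ i, BddBelow (Set.range (f i))) :
    0 ≤ optGap f := by
  refine sub_nonneg.2 (le_ciInf fun x => ?_)
  exact mul_le_mul_of_nonneg_left (Finset.sum_le_sum fun i _ => ciInf_le (hb i) x) (by positivity)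

lemma avgQuadMean_descent_le {n d : ℕ} (hn : 0 < n) (hd : 0 < d) {f : Fin n → Euc d → ℝ} {L μ : ℝ}
    (hL : 0 < L) (hf : ∀ i, LSmooth L (f i)) (hb : ∀ i, BddBelow (Set.range (f i)))
    (hdom : GradDominated μ (globalObj f)) {η : ℝ} (hη : 0 ≤ η) (x : Fin n → Euc d) :
    avgQuadMean (-(η * d)) (η * d / 4) (2 / 3 * L * η ^ 2 * d ^ 2) (fun i => gradient (f i) (x i))
        (fun _ => gradient (globalObj f) (agentAvg x)) ≤
      -(η * μ) * (globalObj f (agentAvg x) - ⨅ y, globalObj f y) + η * L ^ 2 * consensusErr x +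
        2 / 3 * L * η ^ 2 * d *
          (4 * L * (globalObj f (agentAvg x) - (⨅ y, globalObj f y) + optGap f) +
            2 * L ^ 2 * consensusErr x) := by
  have hn' : (n : ℝ) ≠ 0 := by exact_mod_cast hn.ne'
  have hd' : (d : ℝ) ≠ 0 := by exact_mod_cast hd.ne'
  set h := gradient (globalObj f) (agentAvg x) with hh
  set s := agentAvg fun i => gradient (f i) (x i) with hs
  have h1 : avgQuadMean (-(η * d)) (η * d / 4) (2 / 3 * L * η ^ 2 * d ^ 2)
      (fun i => gradient (f i) (x i)) (fun _ => h) =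
      -η * inner ℝ s h + η / 4 * ‖h‖ ^ 2 +
        2 / 3 * L * η ^ 2 * d * ((1 / (n : ℝ)) * ∑ i, ‖gradient (f i) (x i)‖ ^ 2) := by
    rw [avgQuadMean, hs, agentAvg, real_inner_smul_left, sum_inner, ← Finset.sum_div,
      Finset.sum_add_distrib, Finset.sum_add_distrib, ← Finset.mul_sum, ← Finset.mul_sum,
      ← Finset.mul_sum, Finset.sum_const, Finset.card_univ, Fintype.card_fin, nsmul_eq_mul]
    field_simp
  rw [h1]
  have h2 := mul_le_mul_of_nonneg_left (avg_norm_gradient_sq_le hL hf hb x)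
    (by positivity : 0 ≤ 2 / 3 * L * η ^ 2 * d)
  have h3 : 3 / 4 * ‖h‖ ^ 2 - ‖s - h‖ ^ 2 ≤ inner ℝ s h := by
    have e : inner ℝ s h = ‖h‖ ^ 2 + inner ℝ (s - h) h := by
      rw [inner_sub_left, real_inner_self_eq_norm_sq]; ring
    have e2 := neg_le_of_abs_le (abs_real_inner_le_norm (s - h) h)
    nlinarith [sq_nonneg (‖h‖ / 2 - ‖s - h‖)]
  have h4 := mul_le_mul_of_nonneg_left h3 hη
  have h5 := mul_le_mul_of_nonneg_left (norm_agentAvg_gradient_sub_sq_le hf x) hη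
  have h6 := mul_le_mul_of_nonneg_left (hdom.two_mul_sub_iInf_le (agentAvg x))
    (by positivity : 0 ≤ η / 2)
  linarith

lemma avgQuadMean_consensus_le {n d : ℕ} (hd : 0 < d) {f : Fin n → Euc d → ℝ} {L : ℝ}
    (hL : 0 < L) (hf : ∀ i, LSmooth L (f i)) (hb : ∀ i, BddBelow (Set.range (f i)))
    {η κ ρ : ℝ} (hκ : κ * η = (1 - ρ ^ 2) / 4) (hρ : ρ ^ 2 < 1) (x : Fin n → Euc d) :
    ρ ^ 2 * (consensusErr x +
      avgQuadMean (-(2 * η * d)) (η * d * κ) (4 / 3 * η ^ 2 * d ^ 2)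
        (fun i => gradient (f i) (x i)) (fun i => x i - agentAvg x)) ≤
      (1 + ρ ^ 2) / 2 * consensusErr x +
        (4 / 3 * ρ ^ 2 * η ^ 2 * d + 4 * ρ ^ 4 * η ^ 2 / (1 - ρ ^ 2)) *
          (4 * L * (globalObj f (agentAvg x) - (⨅ y, globalObj f y) + optGap f) +
            2 * L ^ 2 * consensusErr x) := by
  have hd' : (d : ℝ) ≠ 0 := by exact_mod_cast hd.ne'
  have hρ' : 0 < 1 - ρ ^ 2 := by linarith
  have h0 : 0 ≤ 4 / 3 * ρ ^ 2 * η ^ 2 * d + 4 * ρ ^ 4 * η ^ 2 / (1 - ρ ^ 2) := by positivity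
  have h2 := mul_le_mul_of_nonneg_left (avg_norm_gradient_sq_le hL hf hb x) h0
  refine le_trans ?_ (add_le_add_right h2 _)
  rw [avgQuadMean, consensusErr, ← mul_add, ← Finset.sum_add_distrib, mul_left_comm,
    mul_left_comm ((1 + ρ ^ 2) / 2), mul_left_comm (4 / 3 * ρ ^ 2 * η ^ 2 * d + _), ← mul_add]
  refine mul_le_mul_of_nonneg_left ?_ (by positivity)
  rw [Finset.mul_sum, Finset.mul_sum, Finset.mul_sum, ← Finset.sum_add_distrib]
  refine Finset.sum_le_sum fun i _ => ?_
  set a := gradient (f i) (x i)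
  set y := x i - agentAvg x
  have e1 : (-(2 * η * d) * inner ℝ a y + η * d * κ * ‖y‖ ^ 2 + 4 / 3 * η ^ 2 * d ^ 2 * ‖a‖ ^ 2) /
      (d : ℝ) =
      -(2 * η) * inner ℝ a y + (1 - ρ ^ 2) / 4 * ‖y‖ ^ 2 + 4 / 3 * η ^ 2 * d * ‖a‖ ^ 2 := by
    rw [← hκ]; field_simp
  rw [e1]
  -- Young's inequality, multiplied through by `ρ²` so that `ρ = 0` needs no separate treatment.
  have e2 : ρ ^ 2 * (-(2 * η) * inner ℝ a y) ≤
      (1 - ρ ^ 2) / 4 * ‖y‖ ^ 2 + 4 * ρ ^ 4 * η ^ 2 / (1 - ρ ^ 2) * ‖a‖ ^ 2 := by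
    have e3 : 0 ≤ ‖((1 - ρ ^ 2) / 2) • y + (2 * ρ ^ 2 * η) • a‖ ^ 2 / (1 - ρ ^ 2) := by positivity
    rw [norm_add_sq_real, norm_smul, norm_smul, mul_pow, mul_pow, Real.norm_eq_abs,
      Real.norm_eq_abs, sq_abs, sq_abs, real_inner_smul_left, real_inner_smul_right,
      real_inner_comm a y] at e3
    have e4 : (((1 - ρ ^ 2) / 2) ^ 2 * ‖y‖ ^ 2 +
        2 * ((1 - ρ ^ 2) / 2 * (2 * ρ ^ 2 * η * inner ℝ a y)) +
        (2 * ρ ^ 2 * η) ^ 2 * ‖a‖ ^ 2) / (1 - ρ ^ 2) =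
        (1 - ρ ^ 2) / 4 * ‖y‖ ^ 2 + 4 * ρ ^ 4 * η ^ 2 / (1 - ρ ^ 2) * ‖a‖ ^ 2 +
        ρ ^ 2 * (2 * η) * inner ℝ a y := by
      field_simp; ring
    rw [e4] at e3
    linarith
  have e5 : ρ ^ 2 * ((1 - ρ ^ 2) / 4 * ‖y‖ ^ 2) ≤ (1 - ρ ^ 2) / 4 * ‖y‖ ^ 2 := by
    have : 0 ≤ (1 - ρ ^ 2) / 4 * ‖y‖ ^ 2 := by positivity
    nlinarith
  linarith

/-! ### The iterates as random variables -/

lemma continuous_twoPointEst {d : ℕ} {f : Euc d → ℝ} (hf : Continuous f) (u : ℝ) {T : Type*}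
    [TopologicalSpace T] {x z : T → Euc d} (hx : Continuous x) (hz : Continuous z) :
    Continuous fun p => twoPointEst f (x p) u (z p) := by
  unfold twoPointEst
  fun_prop

lemma continuous_zoStep {n d : ℕ} (W : Matrix (Fin n) (Fin n) ℝ) {f : Fin n → Euc d → ℝ}
    (hf : ∀ i, Continuous (f i)) (η u : ℝ) :
    Continuous fun p : (Fin n → Euc d) × (Fin n → Euc d) => zoStep W f η u p.1 p.2 := by
  have h1 : ∀ j, Continuous fun p : (Fin n → Euc d) × (Fin n → Euc d) =>
      p.1 j - η • twoPointEst (f j) (p.1 j) u (p.2 j) := by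
    intro j
    have h2 : Continuous fun p : (Fin n → Euc d) × (Fin n → Euc d) => p.1 j := by fun_prop
    have h3 : Continuous fun p : (Fin n → Euc d) × (Fin n → Euc d) => p.2 j := by fun_prop
    exact h2.sub ((continuous_twoPointEst (hf j) u h2 h3).const_smul η)
  unfold zoStep
  refine continuous_pi fun i => ?_
  refine continuous_finsetSum _ fun j _ => ?_
  exact (h1 j).const_smul (W i j)

lemma measurable_zoIter {n d : ℕ} {Θ : Type*} [MeasurableSpace Θ] (W : Matrix (Fin n) (Fin n) ℝ)
    {f : Fin n → Euc d → ℝ} (hf : ∀ i, Continuous (f i)) (η u : ℕ → ℝ) (x0 : Fin n → Euc d)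
    {Z : ℕ → Θ → Fin n → Euc d} (hZ : ∀ t, 1 ≤ t → Measurable (Z t)) (t : ℕ) :
    Measurable fun θ => zoIter W f η u x0 (fun s => Z s θ) t := by
  induction t with
  | zero => exact measurable_const
  | succ t ih =>
    have h := (continuous_zoStep W hf (η (t + 1)) (u (t + 1))).measurable
    have h2 := h.comp (ih.prodMk (hZ (t + 1) (by omega)))
    exact h2

lemma zoIter_congr {n d : ℕ} (W : Matrix (Fin n) (Fin n) ℝ) (f : Fin n → Euc d → ℝ)
    (η u : ℕ → ℝ) (x0 : Fin n → Euc d) {z z' : ℕ → Fin n → Euc d} {t : ℕ}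
    (h : ∀ s, 1 ≤ s → s ≤ t → z s = z' s) :
    zoIter W f η u x0 z t = zoIter W f η u x0 z' t := by
  induction t with
  | zero => rfl
  | succ t ih =>
    have h1 := ih fun s hs hst => h s hs (by omega)
    simp only [zoIter, h1, h (t + 1) (by omega) le_rfl]

/-- For directions on the unit sphere the iterates at each time stay in a fixed compact set. -/
lemma exists_isCompact_zoIter_mem {n d : ℕ} (W : Matrix (Fin n) (Fin n) ℝ)
    {f : Fin n → Euc d → ℝ} (hf : ∀ i, Continuous (f i)) (η u : ℕ → ℝ) (x0 : Fin n → Euc d)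
    (t : ℕ) : ∃ K : Set (Fin n → Euc d), IsCompact K ∧ ∀ z : ℕ → Fin n → Euc d,
      (∀ s, 1 ≤ s → ∀ i, ‖z s i‖ = 1) → zoIter W f η u x0 z t ∈ K := by
  induction t with
  | zero => exact ⟨{x0}, isCompact_singleton, fun z _ => rfl⟩
  | succ t ih =>
    obtain ⟨K, hK, hz⟩ := ih
    refine ⟨_, (hK.prod (isCompact_univ_pi fun _ : Fin n =>
      isCompact_sphere (0 : Euc d) 1)).image (continuous_zoStep W hf (η (t + 1)) (u (t + 1))),
      fun z h => ⟨(zoIter W f η u x0 z t, z (t + 1)), ⟨hz z h, ?_⟩, rfl⟩⟩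
    intro i _
    simpa using h (t + 1) (by omega) i

lemma integrable_comp_of_ae_mem_isCompact {Ω F : Type*} [MeasurableSpace Ω] {P : Measure Ω}
    [IsFiniteMeasure P] [TopologicalSpace F] [MeasurableSpace F] [OpensMeasurableSpace F]
    {Y : Ω → F} (hY : Measurable Y) {K : Set F} (hK : IsCompact K) (hYK : ∀ᵐ ω ∂P, Y ω ∈ K)
    {φ : F → ℝ} (hφ : Continuous φ) : Integrable (fun ω => φ (Y ω)) P := by
  obtain ⟨C, hC⟩ := hK.exists_bound_of_continuousOn hφ.continuousOn
  exact Integrable.of_bound (hφ.measurable.comp hY).aestronglyMeasurable C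
    (hYK.mono fun ω hω => hC _ hω)

/-- The directions used at time `t + 1` are independent of the iterate at time `t`. -/
lemma indepFun_zoIter {n d : ℕ} {Ω : Type*} [MeasurableSpace Ω] {P : Measure Ω}
    (W : Matrix (Fin n) (Fin n) ℝ) {f : Fin n → Euc d → ℝ} (hf : ∀ i, Continuous (f i))
    (η u : ℕ → ℝ) (x0 : Fin n → Euc d) {z : ℕ → Fin n → Ω → Euc d}
    (hz_meas : ∀ t : ℕ, 1 ≤ t → ∀ i, Measurable (z t i))
    (hz_indep : iIndepFun (fun p : {t : ℕ // 1 ≤ t} × Fin n => z p.1 p.2) P) (t : ℕ) (j : Fin n) :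
    IndepFun (fun ω => zoIter W f η u x0 (fun s i => z s i ω) t) (z (t + 1) j) P := by
  classical
  set S : Finset ({t : ℕ // 1 ≤ t} × Fin n) :=
    ((Finset.Icc 1 t).attach.image fun s => ⟨s.1, (Finset.mem_Icc.1 s.2).1⟩) ×ˢ Finset.univ with hS
  have hmemS : ∀ (s : ℕ) (hs : 1 ≤ s) (i : Fin n), s ≤ t → ((⟨s, hs⟩, i) : _ × Fin n) ∈ S := by
    intro s hs i hst
    simp only [hS, Finset.mem_product, Finset.mem_univ, and_true, Finset.mem_image,
      Finset.mem_attach, true_and, Subtype.exists, Finset.mem_Icc]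
    exact ⟨s, ⟨hs, hst⟩, rfl⟩
  set q : {t : ℕ // 1 ≤ t} × Fin n := (⟨t + 1, by omega⟩, j) with hq
  have hdisj : Disjoint S {q} := by
    rw [Finset.disjoint_singleton_right]
    simp only [hS, hq, Finset.mem_product, Finset.mem_univ, and_true, Finset.mem_image,
      Finset.mem_attach, true_and, Subtype.exists, Finset.mem_Icc, Subtype.mk.injEq]
    rintro ⟨s, ⟨_, h⟩, rfl⟩
    omega
  have hind := hz_indep.indepFun_finset S {q} hdisj fun p => hz_meas p.1 p.1.2 p.2
  set Z : ℕ → (S → Euc d) → Fin n → Euc d := fun s θ i =>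
    if h : ∃ h1 : 1 ≤ s, ((⟨s, h1⟩, i) : _ × Fin n) ∈ S then θ ⟨(⟨s, h.1⟩, i), h.2⟩ else 0 with hZ
  have hZm : ∀ s, 1 ≤ s → Measurable (Z s) := by
    intro s _
    refine measurable_pi_lambda _ fun i => ?_
    simp only [hZ]
    split_ifs with h
    · exact measurable_pi_apply _
    · exact measurable_const
  have hcomp := hind.comp (measurable_zoIter W hf η u x0 hZm t)
    (measurable_pi_apply (⟨q, Finset.mem_singleton_self q⟩ : ({q} : Finset _)))
  refine hcomp.congr (Eventually.of_forall fun ω => ?_) (Eventually.of_forall fun ω => rfl)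
  refine zoIter_congr W f η u x0 fun s hs hst => ?_
  funext i
  simp only [hZ]
  rw [dif_pos ⟨hs, hmemS s hs i hst⟩]

/-- A uniformly distributed direction independent of `X` averages the product of two linear forms
with `X`-dependent coefficients to their inner product over `d`. -/
lemma integral_inner_mul_inner {d : ℕ} (hd : 0 < d) {Ω E : Type*} [MeasurableSpace Ω]
    {P : Measure Ω} [IsProbabilityMeasure P] [MeasurableSpace E] {X : Ω → E} {Z : Ω → Euc d}
    (hZ : Measurable Z) (hlaw : P.map Z = uniformSphere d)
    (hind : IndepFun X Z P) {a b : E → Euc d} (ha : Measurable a) (hb : Measurable b)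
    (hint : ∀ k l, Integrable (fun ω => a (X ω) k * b (X ω) l) P) :
    ∫ ω, inner ℝ (a (X ω)) (Z ω) * inner ℝ (b (X ω)) (Z ω) ∂P =
      (∫ ω, inner ℝ (a (X ω)) (b (X ω)) ∂P) / d := by
  have hm : ∀ k l : Fin d, Measurable fun w : Euc d => w k * w l := fun k l => by fun_prop
  have hZint : ∀ k l, Integrable (fun ω => Z ω k * Z ω l) P := by
    intro k l
    have h := integrable_uniformSphere_of_continuous hd (φ := fun w => w k * w l) (by fun_prop)
    rw [← hlaw] at h
    exact h.comp_measurable hZ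
  have hind2 : ∀ k l, IndepFun (fun ω => a (X ω) k * b (X ω) l) (fun ω => Z ω k * Z ω l) P := by
    intro k l
    refine hind.comp (φ := fun e => a e k * b e l) (ψ := fun w : Euc d => w k * w l) ?_ (hm k l)
    exact ((measurable_pi_apply k).comp ((WithLp.measurable_ofLp _ _).comp ha)).mul
      ((measurable_pi_apply l).comp ((WithLp.measurable_ofLp _ _).comp hb))
  have hZval : ∀ k l, ∫ ω, Z ω k * Z ω l ∂P = if k = l then 1 / (d : ℝ) else 0 := by
    intro k l
    rw [← integral_uniformSphere_mul hd k l, ← hlaw,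
      integral_map hZ.aemeasurable (hm k l).aestronglyMeasurable]
  have e1 : ∀ ω, inner ℝ (a (X ω)) (Z ω) * inner ℝ (b (X ω)) (Z ω) =
      ∑ k, ∑ l, (a (X ω) k * b (X ω) l) * (Z ω k * Z ω l) := by
    intro ω
    simp only [PiLp.inner_apply, RCLike.inner_apply, conj_trivial]
    rw [Finset.sum_mul_sum]
    exact Finset.sum_congr rfl fun k _ => Finset.sum_congr rfl fun l _ => by ring
  have e2 : ∀ ω, inner ℝ (a (X ω)) (b (X ω)) = ∑ k, a (X ω) k * b (X ω) k := by
    intro ω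
    simp only [PiLp.inner_apply, RCLike.inner_apply, conj_trivial]
    exact Finset.sum_congr rfl fun k _ => by ring
  have hprod : ∀ k l,
      Integrable (fun ω => a (X ω) k * b (X ω) l * (Z ω k * Z ω l)) P :=
    fun k l => (hind2 k l).integrable_mul (hint k l) (hZint k l)
  simp_rw [e1, e2]
  rw [integral_finsetSum _ fun k _ => hint k k, integral_finsetSum _ fun k _ =>
    integrable_finsetSum _ fun l _ => hprod k l, Finset.sum_div]
  refine Finset.sum_congr rfl fun k _ => ?_
  rw [integral_finsetSum _ fun l _ => hprod k l]
  have e3 : ∀ l, ∫ ω, a (X ω) k * b (X ω) l * (Z ω k * Z ω l) ∂P =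
      (∫ ω, a (X ω) k * b (X ω) l ∂P) * if k = l then 1 / (d : ℝ) else 0 := by
    intro l
    rw [← hZval k l]
    exact (hind2 k l).integral_mul_eq_mul_integral (hint k l).aestronglyMeasurable
      (hZint k l).aestronglyMeasurable
  rw [Finset.sum_congr rfl fun l _ => e3 l]
  simp [div_eq_mul_inv]

lemma integral_linear_combination {Ω : Type*} [MeasurableSpace Ω] {P : Measure Ω} {F₁ F₂ F₃ : Ω → ℝ}
    (h₁ : Integrable F₁ P) (h₂ : Integrable F₂ P) (h₃ : Integrable F₃ P) (c₁ c₂ c₃ : ℝ) :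
    ∫ ω, (c₁ * F₁ ω + c₂ * F₂ ω + c₃ * F₃ ω) ∂P =
      c₁ * ∫ ω, F₁ ω ∂P + c₂ * ∫ ω, F₂ ω ∂P + c₃ * ∫ ω, F₃ ω ∂P := by
  have h12 : Integrable (fun ω => c₁ * F₁ ω + c₂ * F₂ ω) P :=
    (h₁.const_mul c₁).add (h₂.const_mul c₂)
  rw [integral_add h12 (h₃.const_mul c₃), integral_add (h₁.const_mul c₁) (h₂.const_mul c₂),
    integral_const_mul, integral_const_mul, integral_const_mul]

/-- `X` is a bounded random configuration of the agents and the `Z i` are uniformly distributed unit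
directions, each independent of `X`. No joint independence of the `Z i` is recorded: the estimates
only involve one direction at a time. -/
structure FreshDirections {n d : ℕ} {Ω : Type*} [MeasurableSpace Ω] (P : Measure Ω)
    (X Z : Ω → Fin n → Euc d) : Prop where
  measurable_config : Measurable X
  measurable_dir : Measurable Z
  ae_mem_compact : ∃ K : Set (Fin n → Euc d), IsCompact K ∧ ∀ᵐ ω ∂P, X ω ∈ K
  ae_norm_dir : ∀ᵐ ω ∂P, ∀ i, ‖Z ω i‖ = 1
  map_dir : ∀ i, P.map (fun ω => Z ω i) = uniformSphere d
  indep : ∀ i, IndepFun X (fun ω => Z ω i) P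

section FreshDirections

variable {n d : ℕ} {Ω : Type*} [MeasurableSpace Ω] {P : Measure Ω} [IsProbabilityMeasure P]
  {X Z : Ω → Fin n → Euc d}

lemma FreshDirections.integrable_prod (h : FreshDirections P X Z)
    {φ : (Fin n → Euc d) × (Fin n → Euc d) → ℝ} (hφ : Continuous φ) :
    Integrable (fun ω => φ (X ω, Z ω)) P := by
  obtain ⟨K, hK, hXK⟩ := h.ae_mem_compact
  refine integrable_comp_of_ae_mem_isCompact (h.measurable_config.prodMk h.measurable_dir)
    (hK.prod (isCompact_univ_pi fun _ : Fin n => isCompact_sphere (0 : Euc d) 1)) ?_ hφ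
  filter_upwards [hXK, h.ae_norm_dir] with ω h1 h2
  exact ⟨h1, fun i _ => by simpa using h2 i⟩

lemma FreshDirections.integrable (h : FreshDirections P X Z) {φ : (Fin n → Euc d) → ℝ}
    (hφ : Continuous φ) : Integrable (fun ω => φ (X ω)) P :=
  h.integrable_prod (φ := fun p => φ p.1) (hφ.comp continuous_fst)

/-- Given `X`, the mean of `avgQuad` over the directions is `avgQuadMean`. -/
lemma FreshDirections.integral_avgQuad (h : FreshDirections P X Z) (hd : 0 < d)
    {a b : (Fin n → Euc d) → Fin n → Euc d} (ha : Continuous a) (hb : Continuous b)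
    (c₁ c₂ c₃ : ℝ) :
    Integrable (fun ω => avgQuad c₁ c₂ c₃ (a (X ω)) (b (X ω)) (Z ω)) P ∧
    Integrable (fun ω => avgQuadMean c₁ c₂ c₃ (a (X ω)) (b (X ω))) P ∧
    ∫ ω, avgQuad c₁ c₂ c₃ (a (X ω)) (b (X ω)) (Z ω) ∂P =
      ∫ ω, avgQuadMean c₁ c₂ c₃ (a (X ω)) (b (X ω)) ∂P := by
  have hai : ∀ i, Continuous fun x => a x i := fun i => (continuous_apply i).comp ha
  have hbi : ∀ i, Continuous fun x => b x i := fun i => (continuous_apply i).comp hb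
  have hXint : ∀ φ : (Fin n → Euc d) → ℝ, Continuous φ → Integrable (fun ω => φ (X ω)) P :=
    fun φ hφ => h.integrable hφ
  have hZi : ∀ i, Measurable fun ω => Z ω i :=
    fun i => (measurable_pi_apply i).comp h.measurable_dir
  have key : ∀ (i : Fin n) (a' b' : (Fin n → Euc d) → Euc d), Continuous a' → Continuous b' →
      Integrable (fun ω => inner ℝ (a' (X ω)) (Z ω i) * inner ℝ (b' (X ω)) (Z ω i)) P ∧
      ∫ ω, inner ℝ (a' (X ω)) (Z ω i) * inner ℝ (b' (X ω)) (Z ω i) ∂P =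
        (∫ ω, inner ℝ (a' (X ω)) (b' (X ω)) ∂P) / d := by
    intro i a' b' ha' hb'
    refine ⟨h.integrable_prod
      (φ := fun p => inner ℝ (a' p.1) (p.2 i) * inner ℝ (b' p.1) (p.2 i)) (by fun_prop), ?_⟩
    exact integral_inner_mul_inner hd (hZi i) (h.map_dir i) (h.indep i) ha'.measurable
      hb'.measurable fun k l => hXint (fun x => a' x k * b' x l) (by fun_prop)
  have hq : ∀ i, Integrable (fun ω => c₁ * (inner ℝ (a (X ω) i) (Z ω i) *
      inner ℝ (b (X ω) i) (Z ω i)) + c₂ * inner ℝ (b (X ω) i) (Z ω i) ^ 2 +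
      c₃ * inner ℝ (a (X ω) i) (Z ω i) ^ 2) P ∧
      Integrable (fun ω => (c₁ * inner ℝ (a (X ω) i) (b (X ω) i) + c₂ * ‖b (X ω) i‖ ^ 2 +
        c₃ * ‖a (X ω) i‖ ^ 2) / (d : ℝ)) P ∧
      ∫ ω, (c₁ * (inner ℝ (a (X ω) i) (Z ω i) *
      inner ℝ (b (X ω) i) (Z ω i)) + c₂ * inner ℝ (b (X ω) i) (Z ω i) ^ 2 +
      c₃ * inner ℝ (a (X ω) i) (Z ω i) ^ 2) ∂P =
      ∫ ω, (c₁ * inner ℝ (a (X ω) i) (b (X ω) i) + c₂ * ‖b (X ω) i‖ ^ 2 +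
        c₃ * ‖a (X ω) i‖ ^ 2) / (d : ℝ) ∂P := by
    intro i
    obtain ⟨i1, v1⟩ := key i _ _ (hai i) (hbi i)
    obtain ⟨i2, v2⟩ := key i _ _ (hbi i) (hbi i)
    obtain ⟨i3, v3⟩ := key i _ _ (hai i) (hai i)
    have j1 := hXint (fun x => inner ℝ (a x i) (b x i)) (by have := hai i; have := hbi i; fun_prop)
    have j2 := hXint (fun x => inner ℝ (b x i) (b x i)) (by have := hbi i; fun_prop)
    have j3 := hXint (fun x => inner ℝ (a x i) (a x i)) (by have := hai i; fun_prop)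
    simp only [sq (inner ℝ _ _), ← real_inner_self_eq_norm_sq]
    refine ⟨((i1.const_mul c₁).add (i2.const_mul c₂)).add (i3.const_mul c₃),
      (((j1.const_mul c₁).add (j2.const_mul c₂)).add (j3.const_mul c₃)).div_const _, ?_⟩
    rw [integral_div, integral_linear_combination i1 i2 i3, integral_linear_combination j1 j2 j3,
      v1, v2, v3]
    ring
  refine ⟨(integrable_finsetSum _ fun i _ => (hq i).1).const_mul _,
    (integrable_finsetSum _ fun i _ => (hq i).2.1).const_mul _, ?_⟩
  unfold avgQuad avgQuadMean
  rw [integral_const_mul, integral_const_mul, integral_finsetSum _ fun i _ => (hq i).1,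
    integral_finsetSum _ fun i _ => (hq i).2.1]
  exact congrArg _ (Finset.sum_congr rfl fun i _ => (hq i).2.2)

end FreshDirections

/-! ### The recursion in expectation -/

lemma continuous_agentAvg {n d : ℕ} : Continuous (agentAvg : (Fin n → Euc d) → Euc d) := by
  unfold agentAvg
  fun_prop

lemma continuous_consensusErr {n d : ℕ} :
    Continuous (consensusErr : (Fin n → Euc d) → ℝ) := by
  have := continuous_agentAvg (n := n) (d := d)
  unfold consensusErr
  fun_prop

section Expectation

variable {n d : ℕ} {Ω : Type*} [MeasurableSpace Ω] {P : Measure Ω} [IsProbabilityMeasure P]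
  {X Z : Ω → Fin n → Euc d}

lemma FreshDirections.integrable_zoStep (h : FreshDirections P X Z)
    (W : Matrix (Fin n) (Fin n) ℝ) {f : Fin n → Euc d → ℝ} (hf : ∀ i, Continuous (f i))
    (η u : ℝ) {φ : (Fin n → Euc d) → ℝ} (hφ : Continuous φ) :
    Integrable (fun ω => φ (zoStep W f η u (X ω) (Z ω))) P := by
  have h1 := hφ.comp (continuous_zoStep W hf η u)
  have h2 := h.integrable_prod h1
  exact h2

/-- Recursion for the expected optimality gap. -/
lemma FreshDirections.integral_globalObj_zoStep_le (h : FreshDirections P X Z) (hn : 0 < n)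
    (hd : 0 < d) {W : Matrix (Fin n) (Fin n) ℝ} (hW : W ∈ doublyStochastic ℝ (Fin n))
    {f : Fin n → Euc d → ℝ} {L μ : ℝ} (hL : 0 < L) (hf : ∀ i, LSmooth L (f i))
    (hb : ∀ i, BddBelow (Set.range (f i))) (hdom : GradDominated μ (globalObj f))
    {η u : ℝ} (hη : 0 ≤ η) (hu : 0 < u) :
    ∫ ω, (globalObj f (agentAvg (zoStep W f η u (X ω) (Z ω))) - ⨅ y, globalObj f y) ∂P ≤
      (1 - η * μ + 8 / 3 * L ^ 2 * d * η ^ 2) *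
          ∫ ω, (globalObj f (agentAvg (X ω)) - ⨅ y, globalObj f y) ∂P +
        (η * L ^ 2 + 4 / 3 * L ^ 3 * d * η ^ 2) * ∫ ω, consensusErr (X ω) ∂P +
        8 / 3 * L ^ 2 * d * η ^ 2 * optGap f +
        (η * d * (L ^ 2 * u ^ 2) / 4 + L / 2 * η ^ 2 * (d ^ 2 * (L ^ 2 * u ^ 2))) := by
  have hF := (LSmooth.globalObj hn hf).1.continuous
  have hgF := (LSmooth.globalObj hn hf).continuous_gradient
  have hδc : Continuous fun x : Fin n → Euc d => globalObj f (agentAvg x) - ⨅ y, globalObj f y :=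
    (hF.comp continuous_agentAvg).sub continuous_const
  have hac : Continuous fun (x : Fin n → Euc d) i => gradient (f i) (x i) :=
    continuous_pi fun i => (hf i).continuous_gradient.comp (continuous_apply i)
  have hbc : Continuous fun (x : Fin n → Euc d) (_ : Fin n) =>
      gradient (globalObj f) (agentAvg x) :=
    continuous_pi fun _ => hgF.comp continuous_agentAvg
  obtain ⟨q1, q2, q3⟩ := h.integral_avgQuad hd hac hbc (-(η * d)) (η * d / 4)
    (2 / 3 * L * η ^ 2 * d ^ 2)
  have i1 := h.integrable hδc
  have i2 := h.integrable (continuous_consensusErr (n := n) (d := d))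
  have i3 := h.integrable_zoStep W (fun i => (hf i).1.continuous) η u hδc
  set c := η * d * (L ^ 2 * u ^ 2) / 4 + L / 2 * η ^ 2 * (d ^ 2 * (L ^ 2 * u ^ 2)) with hc
  have ic : Integrable (fun _ : Ω => (1 : ℝ)) P := integrable_const 1
  have s1 : ∫ ω, (globalObj f (agentAvg (zoStep W f η u (X ω) (Z ω))) - ⨅ y, globalObj f y) ∂P ≤
      ∫ ω, (1 * (globalObj f (agentAvg (X ω)) - ⨅ y, globalObj f y) + c * 1 +
        1 * avgQuad (-(η * d)) (η * d / 4) (2 / 3 * L * η ^ 2 * d ^ 2)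
          (fun i => gradient (f i) (X ω i)) (fun _ => gradient (globalObj f) (agentAvg (X ω)))
          (Z ω)) ∂P := by
    refine integral_mono_ae i3 (((i1.const_mul _).add (ic.const_mul _)).add (q1.const_mul _)) ?_
    filter_upwards [h.ae_norm_dir] with ω hω
    have := globalObj_zoStep_le hn hW hL hf hη hu (X ω) hω
    rw [← hc] at this
    linarith
  rw [integral_linear_combination i1 ic q1, q3] at s1
  have s2 : ∫ ω, avgQuadMean (-(η * d)) (η * d / 4) (2 / 3 * L * η ^ 2 * d ^ 2)
      (fun i => gradient (f i) (X ω i)) (fun _ => gradient (globalObj f) (agentAvg (X ω))) ∂P ≤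
      ∫ ω, ((-(η * μ) + 8 / 3 * L ^ 2 * d * η ^ 2) *
          (globalObj f (agentAvg (X ω)) - ⨅ y, globalObj f y) +
        (η * L ^ 2 + 4 / 3 * L ^ 3 * d * η ^ 2) * consensusErr (X ω) +
        8 / 3 * L ^ 2 * d * η ^ 2 * optGap f * 1) ∂P := by
    refine integral_mono q2 (((i1.const_mul _).add (i2.const_mul _)).add
      (ic.const_mul _)) fun ω => ?_
    have := avgQuadMean_descent_le hn hd hL hf hb hdom hη (X ω)
    simp only
    linarith
  rw [integral_linear_combination i1 i2 ic] at s2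
  simp only [integral_const, probReal_univ, smul_eq_mul, mul_one] at s1 s2
  linarith

/-- Recursion for the expected consensus error. -/
lemma FreshDirections.integral_consensusErr_zoStep_le (h : FreshDirections P X Z) (hn : 0 < n)
    (hd : 0 < d) {W : Matrix (Fin n) (Fin n) ℝ} (hW : W ∈ doublyStochastic ℝ (Fin n))
    (hρ : netRho W ^ 2 < 1) {f : Fin n → Euc d → ℝ} {L : ℝ} (hL : 0 < L)
    (hf : ∀ i, LSmooth L (f i)) (hb : ∀ i, BddBelow (Set.range (f i)))
    {η u : ℝ} (hη : 0 < η) (hu : 0 < u) :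
    ∫ ω, consensusErr (zoStep W f η u (X ω) (Z ω)) ∂P ≤
      (1 + netRho W ^ 2) / 2 * ∫ ω, consensusErr (X ω) ∂P +
        (4 / 3 * netRho W ^ 2 * d + 4 * netRho W ^ 4 / (1 - netRho W ^ 2)) * η ^ 2 *
          (4 * L * (∫ ω, (globalObj f (agentAvg (X ω)) - ⨅ y, globalObj f y) ∂P + optGap f) +
            2 * L ^ 2 * ∫ ω, consensusErr (X ω) ∂P) +
        netRho W ^ 2 * (d / (1 - netRho W ^ 2) + d ^ 2) * L ^ 2 * (η ^ 2 * u ^ 2) := by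
  have hF := (LSmooth.globalObj hn hf).1.continuous
  have hδc : Continuous fun x : Fin n → Euc d => globalObj f (agentAvg x) - ⨅ y, globalObj f y :=
    (hF.comp continuous_agentAvg).sub continuous_const
  have hac : Continuous fun (x : Fin n → Euc d) i => gradient (f i) (x i) :=
    continuous_pi fun i => (hf i).continuous_gradient.comp (continuous_apply i)
  have hbc : Continuous fun (x : Fin n → Euc d) i => x i - agentAvg x :=
    continuous_pi fun i => (continuous_apply i).sub continuous_agentAvg
  set ρ := netRho W
  have hρ' : 0 < 1 - ρ ^ 2 := by linarith
  -- The weight in Young's inequality that costs `(1 - ρ²)/4` of the contraction.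
  set κ := (1 - ρ ^ 2) / (4 * η) with hκ
  have hκ0 : 0 < κ := by positivity
  have hκη : κ * η = (1 - ρ ^ 2) / 4 := by rw [hκ]; field_simp
  obtain ⟨q1, q2, q3⟩ := h.integral_avgQuad hd hac hbc (-(2 * η * d)) (η * d * κ)
    (4 / 3 * η ^ 2 * d ^ 2)
  have i1 := h.integrable hδc
  have i2 := h.integrable (continuous_consensusErr (n := n) (d := d))
  have i3 := h.integrable_zoStep W (fun i => (hf i).1.continuous) η u
    (continuous_consensusErr (n := n) (d := d))
  set c := η * d * (L ^ 2 * u ^ 2) / (4 * κ) + η ^ 2 * (d ^ 2 * (L ^ 2 * u ^ 2)) with hc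
  have ic : Integrable (fun _ : Ω => (1 : ℝ)) P := integrable_const 1
  have hcval : c = (d / (1 - ρ ^ 2) + d ^ 2) * L ^ 2 * (η ^ 2 * u ^ 2) := by
    rw [hc, hκ]; field_simp
  have s1 : ∫ ω, consensusErr (zoStep W f η u (X ω) (Z ω)) ∂P ≤
      ∫ ω, (ρ ^ 2 * consensusErr (X ω) + ρ ^ 2 * c * 1 +
        ρ ^ 2 * avgQuad (-(2 * η * d)) (η * d * κ) (4 / 3 * η ^ 2 * d ^ 2)
          (fun i => gradient (f i) (X ω i)) (fun i => X ω i - agentAvg (X ω)) (Z ω)) ∂P := by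
    refine integral_mono_ae i3 (((i2.const_mul _).add (ic.const_mul _)).add (q1.const_mul _)) ?_
    filter_upwards [h.ae_norm_dir] with ω hω
    have := consensusErr_zoStep_le hn hW hf hη.le hu hκ0 (X ω) hω
    rw [← hc] at this
    linarith
  rw [integral_linear_combination i2 ic q1, q3] at s1
  set B := 4 / 3 * ρ ^ 2 * η ^ 2 * d + 4 * ρ ^ 4 * η ^ 2 / (1 - ρ ^ 2) with hB
  have hBval : B = (4 / 3 * ρ ^ 2 * d + 4 * ρ ^ 4 / (1 - ρ ^ 2)) * η ^ 2 := by
    rw [hB]; field_simp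
  have s2 : ∫ ω, (ρ ^ 2 * consensusErr (X ω) +
        ρ ^ 2 * avgQuadMean (-(2 * η * d)) (η * d * κ) (4 / 3 * η ^ 2 * d ^ 2)
          (fun i => gradient (f i) (X ω i)) (fun i => X ω i - agentAvg (X ω)) + 0 * 1) ∂P ≤
      ∫ ω, (((1 + ρ ^ 2) / 2 + B * (2 * L ^ 2)) * consensusErr (X ω) +
        B * (4 * L) * (globalObj f (agentAvg (X ω)) - ⨅ y, globalObj f y) +
        B * (4 * L) * optGap f * 1) ∂P := by
    refine integral_mono (((i2.const_mul _).add (q2.const_mul _)).add (ic.const_mul 0))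
      (((i2.const_mul _).add (i1.const_mul _)).add (ic.const_mul _)) fun ω => ?_
    have := avgQuadMean_consensus_le hd hL hf hb hκη hρ (X ω)
    rw [← hB] at this
    simp only
    linarith
  rw [integral_linear_combination i2 q2 ic, integral_linear_combination i2 i1 ic] at s2
  simp only [integral_const, probReal_univ, smul_eq_mul, mul_one, add_zero] at s1 s2
  rw [← hBval, mul_assoc (ρ ^ 2), mul_assoc (ρ ^ 2), ← hcval]
  linarith

end Expectation

lemma freshDirections_zoIter {n d : ℕ} {Ω : Type*} [MeasurableSpace Ω] {P : Measure Ω}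
    (W : Matrix (Fin n) (Fin n) ℝ) {f : Fin n → Euc d → ℝ} (hf : ∀ i, Continuous (f i))
    (η u : ℕ → ℝ) (x0 : Fin n → Euc d) {z : ℕ → Fin n → Ω → Euc d}
    (hz_meas : ∀ t : ℕ, 1 ≤ t → ∀ i, Measurable (z t i))
    (hz_law : ∀ t : ℕ, 1 ≤ t → ∀ i, P.map (z t i) = uniformSphere d)
    (hz_indep : iIndepFun (fun p : {t : ℕ // 1 ≤ t} × Fin n => z p.1 p.2) P) (t : ℕ) :
    FreshDirections P (fun ω => zoIter W f η u x0 (fun s i => z s i ω) t)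
      (fun ω i => z (t + 1) i ω) := by
  have hnorm : ∀ s, 1 ≤ s → ∀ i, ∀ᵐ ω ∂P, ‖z s i ω‖ = 1 := by
    intro s hs i
    have h1 := ae_uniformSphere_norm_eq_one d
    rw [← hz_law s hs i] at h1
    exact ae_of_ae_map (hz_meas s hs i).aemeasurable h1
  have hZm : ∀ s, 1 ≤ s → Measurable fun ω i => z s i ω := fun s hs =>
    measurable_pi_lambda _ fun i => hz_meas s hs i
  refine ⟨measurable_zoIter W hf η u x0 (Z := fun s ω i => z s i ω) hZm t, hZm _ (by omega), ?_,
    ae_all_iff.2 fun i => hnorm _ (by omega) i, fun i => hz_law _ (by omega) i,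
    fun i => indepFun_zoIter W hf η u x0 hz_meas hz_indep t i⟩
  obtain ⟨K, hK, hmem⟩ := exists_isCompact_zoIter_mem W hf η u x0 t
  refine ⟨K, hK, ?_⟩
  have hall : ∀ᵐ ω ∂P, ∀ s, 1 ≤ s → ∀ i, ‖z s i ω‖ = 1 :=
    ae_all_iff.2 fun s => by
      by_cases hs : 1 ≤ s
      · filter_upwards [ae_all_iff.2 fun i => hnorm s hs i] with ω hω _ i using hω i
      · exact Eventually.of_forall fun ω h => absurd h hs
  filter_upwards [hall] with ω hω
  exact hmem _ hω

/-! ### Convergence rates -/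

/-- The two recursions with `η = A / s` and `u² ≤ U / s` are of the form required by
`eventually_le_of_coupled_recursion`. -/
lemma rates_of_step_recursion {δ v η u : ℕ → ℝ} {b A U L μ q D E G H F : ℝ} (hb : 0 < b)
    (hA : 0 < A) (hU : 0 ≤ U) (hL : 0 < L) (hAμ : 1 < A * μ) (hq0 : 0 ≤ q) (hq : q < 1)
    (hD : 0 ≤ D) (hE : 0 ≤ E) (hF : 0 ≤ F)
    (hδ0 : ∀ t, 0 ≤ δ t) (hv0 : ∀ t, 0 ≤ v t)
    (hη : ∀ t : ℕ, η t = A / (t + b)) (hu : ∀ t : ℕ, u t ^ 2 ≤ U / (t + b))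
    (hδ : ∀ t : ℕ, δ (t + 1) ≤ (1 - η t * μ + 8 / 3 * L ^ 2 * D * η t ^ 2) * δ t +
      (η t * L ^ 2 + 4 / 3 * L ^ 3 * D * η t ^ 2) * v t + 8 / 3 * L ^ 2 * D * η t ^ 2 * G +
      (η t * D * (L ^ 2 * u t ^ 2) / 4 + L / 2 * η t ^ 2 * (D ^ 2 * (L ^ 2 * u t ^ 2))))
    (hv : ∀ t : ℕ, v (t + 1) ≤ q * v t + E * η t ^ 2 *
        (4 * L * (δ t + G) + 2 * L ^ 2 * v t) + F * (η t ^ 2 * u t ^ 2))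
    (hH : H = 8 / 3 * L ^ 2 * D * A ^ 2 * G + A * D * L ^ 2 * U / 4) :
    (∀ ε > 0, ∀ᶠ t : ℕ in atTop, δ t * (t + b) ≤ H / (A * μ - 1) + ε) ∧
    (∀ ε > 0, ∀ᶠ t : ℕ in atTop, v t * (t + b) ^ 2 ≤ 4 * L * G * E * A ^ 2 / (1 - q) + ε) := by
  set C₁ := 8 / 3 * L ^ 2 * D * A ^ 2 with hC₁
  set C₂ := A * L ^ 2 with hC₂
  set C₃ := 4 / 3 * L ^ 3 * D * A ^ 2 with hC₃
  set C₄ := L / 2 * A ^ 2 * D ^ 2 * L ^ 2 * U with hC₄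
  set C₅ := 2 * L ^ 2 * E * A ^ 2 with hC₅
  set C₆ := 4 * L * E * A ^ 2 with hC₆
  set C₇ := F * A ^ 2 * U with hC₇
  have p₁ : 0 ≤ C₁ := by positivity
  have p₂ : 0 ≤ C₂ := by positivity
  have p₃ : 0 ≤ C₃ := by positivity
  have p₄ : 0 ≤ C₄ := by positivity
  have p₅ : 0 ≤ C₅ := by positivity
  have p₆ : 0 ≤ C₆ := by positivity
  have p₇ : 0 ≤ C₇ := by positivity
  set C := C₁ + C₂ + C₃ + C₄ + C₅ + C₆ + C₇ with hC
  refine eventually_le_of_coupled_recursion (C := C) hb hAμ hq0 hq (by positivity) hδ0 hv0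
    (fun t => ?_) (fun t => ?_)
  · have hs : 0 < (t : ℝ) + b := by positivity
    have h1 := hδ t
    have h2 : η t * D * (L ^ 2 * u t ^ 2) / 4 + L / 2 * η t ^ 2 * (D ^ 2 * (L ^ 2 * u t ^ 2)) ≤
        A * D * L ^ 2 * U / 4 / (t + b) ^ 2 + C₄ / (t + b) ^ 3 := by
      have e : A * D * L ^ 2 * U / 4 / (t + b) ^ 2 + C₄ / (t + b) ^ 3 =
          η t * D * (L ^ 2 * (U / (t + b))) / 4 +
            L / 2 * η t ^ 2 * (D ^ 2 * (L ^ 2 * (U / (t + b)))) := by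
        rw [hη, hC₄]; field_simp
      have hη0 : 0 ≤ η t := by rw [hη]; positivity
      rw [e]
      have := hu t
      gcongr
    have h3 : (1 - η t * μ + 8 / 3 * L ^ 2 * D * η t ^ 2) * δ t ≤
        (1 - A * μ / (t + b) + C / (t + b) ^ 2) * δ t := by
      have e : 1 - η t * μ + 8 / 3 * L ^ 2 * D * η t ^ 2 =
          1 - A * μ / (t + b) + C₁ / (t + b) ^ 2 := by rw [hη, hC₁]; field_simp
      rw [e]
      have : C₁ ≤ C := by linarith
      have := hδ0 t
      gcongr
    have h4 : (η t * L ^ 2 + 4 / 3 * L ^ 3 * D * η t ^ 2) * v t ≤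
        (C / (t + b) + C / (t + b) ^ 2) * v t := by
      have e : η t * L ^ 2 + 4 / 3 * L ^ 3 * D * η t ^ 2 =
          C₂ / (t + b) + C₃ / (t + b) ^ 2 := by rw [hη, hC₂, hC₃]; field_simp
      rw [e]
      have : C₂ ≤ C := by linarith
      have : C₃ ≤ C := by linarith
      have := hv0 t
      gcongr
    have h5 : C₄ / (t + b) ^ 3 ≤ C / (t + b) ^ 3 := by
      have : C₄ ≤ C := by linarith
      gcongr
    have h6 : H / (t + b) ^ 2 =
        8 / 3 * L ^ 2 * D * η t ^ 2 * G + A * D * L ^ 2 * U / 4 / (t + b) ^ 2 := by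
      rw [hη, hH, hC₁]; field_simp
    rw [h6]
    linarith
  · have hs : 0 < (t : ℝ) + b := by positivity
    have h1 := hv t
    have h2 : F * (η t ^ 2 * u t ^ 2) ≤ C / (t + b) ^ 3 := by
      calc F * (η t ^ 2 * u t ^ 2) ≤ F * (η t ^ 2 * (U / (t + b))) := by
            have := hu t
            gcongr
        _ = C₇ / (t + b) ^ 3 := by rw [hη, hC₇]; field_simp
        _ ≤ C / (t + b) ^ 3 := by
            have : C₇ ≤ C := by linarith
            gcongr
    have h3 : E * η t ^ 2 * (4 * L * (δ t + G) + 2 * L ^ 2 * v t) =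
        C₆ / (t + b) ^ 2 * δ t + C₅ / (t + b) ^ 2 * v t +
          4 * L * G * E * A ^ 2 / (t + b) ^ 2 := by
      rw [hη, hC₆, hC₅]; field_simp; ring
    have h4 : C₆ / (t + b) ^ 2 * δ t ≤ C / (t + b) ^ 2 * δ t := by
      have : C₆ ≤ C := by linarith
      have := hδ0 t
      gcongr
    have h5 : C₅ / (t + b) ^ 2 * v t ≤ C / (t + b) ^ 2 * v t := by
      have : C₅ ≤ C := by linarith
      have := hv0 t
      gcongr
    linarith

theorem theorem2 {n d : ℕ} (hd : 0 < d)
    (G : SimpleGraph (Fin n)) (hG : G.Connected)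
    (W : Matrix (Fin n) (Fin n) ℝ) (hW : IsConsensusMatrix G W)
    (f : Fin n → Euc d → ℝ) (L μ : ℝ) (hL : 0 < L) (hμ : 0 < μ)
    (hsmooth : ∀ i, LSmooth L (f i))
    (hbdd : ∀ i, BddBelow (Set.range (f i)))
    (hdom : GradDominated μ (globalObj f))
    (αη αu t0 : ℝ) (hαη : 1 < αη) (hαu : 0 < αu)
    (ht0 : 2 * αη * L / (μ * (1 - netRho W ^ 2)) * (32 * L * d / (3 * μ) + 9 * netRho W) - 1 ≤ t0)
    (η u : ℕ → ℝ)
    (hη : ∀ t : ℕ, 1 ≤ t → η t = 2 * αη / (μ * (t + t0)))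
    (hu : ∀ t : ℕ, 1 ≤ t → 0 < u t ∧ u t ≤ αu / Real.sqrt (t + t0))
    (x0 : Fin n → Euc d)
    {Ω : Type*} [MeasurableSpace Ω] (P : Measure Ω) [IsProbabilityMeasure P]
    (z : ℕ → Fin n → Ω → Euc d)
    (hz_meas : ∀ t : ℕ, 1 ≤ t → ∀ i, Measurable (z t i))
    (hz_law : ∀ t : ℕ, 1 ≤ t → ∀ i, P.map (z t i) = uniformSphere d)
    (hz_indep : iIndepFun (fun p : {t : ℕ // 1 ≤ t} × Fin n => z p.1 p.2) P)
    (x : ℕ → Ω → Fin n → Euc d)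
    (hx : ∀ t ω, x t ω = zoIter W f η u x0 (fun s i => z s i ω) t) :
    ((∀ t, Integrable (fun ω => globalObj f (agentAvg (x t ω)) - ⨅ y, globalObj f y) P) ∧
      ∃ r : ℕ → ℝ, r =o[atTop] (fun t : ℕ => 1 / (t : ℝ)) ∧
        ∀ t : ℕ, 1 ≤ t →
          ∫ ω, (globalObj f (agentAvg (x t ω)) - ⨅ y, globalObj f y) ∂P ≤
            (32 * αη ^ 2 * L ^ 2 * optGap f / μ ^ 2 + 6 * αη * αu ^ 2 * L ^ 2 / μ) * (d / t)
              + r t) ∧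
    ((∀ t i, Integrable (fun ω => ‖x t ω i - agentAvg (x t ω)‖ ^ 2) P) ∧
      ∃ r : ℕ → ℝ, r =o[atTop] (fun t : ℕ => 1 / (t : ℝ) ^ 2) ∧
        ∀ t : ℕ, 1 ≤ t →
          (1 / (n : ℝ)) * ∑ i, ∫ ω, ‖x t ω i - agentAvg (x t ω)‖ ^ 2 ∂P ≤
            32 * αη ^ 2 * netRho W ^ 2 * L * optGap f / (μ ^ 2 * (1 - netRho W ^ 2))
                * (4 * d / 3 + 6 * netRho W ^ 2 / (1 - netRho W ^ 2)) * (1 / (t : ℝ) ^ 2)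
              + r t) := by
  obtain rfl : x = fun t ω => zoIter W f η u x0 (fun s i => z s i ω) t :=
    funext fun t => funext fun ω => hx t ω
  have hn : 0 < n := Fin.pos_iff_nonempty.2 hG.nonempty
  have hd' : (0 : ℝ) < d := by exact_mod_cast hd
  have hd1 : (1 : ℝ) ≤ d := by exact_mod_cast hd
  have hρ0 := netRho_nonneg W
  have hρ1 := netRho_lt_one hG hW
  set ρ := netRho W with hρ
  have hρ2 : ρ ^ 2 < 1 := by nlinarith
  have hρ' : 0 < 1 - ρ ^ 2 := by linarith
  have hb : 0 < 1 + t0 := by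
    have : 0 < 2 * αη * L / (μ * (1 - ρ ^ 2)) * (32 * L * d / (3 * μ) + 9 * ρ) := by positivity
    linarith
  have hds := hW.doubly_stochastic
  have hcont : ∀ i, Continuous (f i) := fun i => (hsmooth i).1.continuous
  have hΔ := optGap_nonneg hbdd
  have hfresh := freshDirections_zoIter W hcont η u x0 hz_meas hz_law hz_indep
  set X : ℕ → Ω → Fin n → Euc d := fun t ω => zoIter W f η u x0 (fun s i => z s i ω) t with hX
  have hδc : Continuous fun x : Fin n → Euc d => globalObj f (agentAvg x) - ⨅ y, globalObj f y :=
    ((LSmooth.globalObj hn hsmooth).1.continuous.comp continuous_agentAvg).sub continuous_const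
  have hdist : ∀ i, Continuous fun x : Fin n → Euc d => ‖x i - agentAvg x‖ ^ 2 := fun i =>
    (((continuous_apply i).sub continuous_agentAvg).norm.pow 2)
  set δ : ℕ → ℝ := fun t => ∫ ω, (globalObj f (agentAvg (X t ω)) - ⨅ y, globalObj f y) ∂P with hδ
  set v : ℕ → ℝ := fun t => ∫ ω, consensusErr (X t ω) ∂P with hv
  have hs : ∀ t : ℕ, 0 < (t : ℝ) + (1 + t0) := fun t => by positivity
  have hη' : ∀ t : ℕ, η (t + 1) = 2 * αη / μ / (t + (1 + t0)) := by
    intro t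
    rw [hη (t + 1) (by omega), div_div]
    push_cast
    ring_nf
  have hu0 : ∀ t : ℕ, 0 < u (t + 1) := fun t => (hu (t + 1) (by omega)).1
  have hu' : ∀ t : ℕ, u (t + 1) ^ 2 ≤ αu ^ 2 / (t + (1 + t0)) := by
    intro t
    have h1 := pow_le_pow_left₀ (hu0 t).le (hu (t + 1) (by omega)).2 2
    have e : ((t + 1 : ℕ) : ℝ) + t0 = t + (1 + t0) := by push_cast; ring
    rwa [e, div_pow, Real.sq_sqrt (hs t).le] at h1
  have hη0 : ∀ t : ℕ, 0 < η (t + 1) := fun t => by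
    rw [hη']
    have := hs t
    positivity
  obtain ⟨hrate₁, hrate₂⟩ := rates_of_step_recursion (δ := δ) (v := v)
    (η := fun t => η (t + 1)) (u := fun t => u (t + 1)) (b := 1 + t0) (A := 2 * αη / μ)
    (U := αu ^ 2) (L := L) (μ := μ) (q := (1 + ρ ^ 2) / 2) (D := d)
    (E := 4 / 3 * ρ ^ 2 * d + 4 * ρ ^ 4 / (1 - ρ ^ 2)) (G := optGap f)
    (F := ρ ^ 2 * (d / (1 - ρ ^ 2) + d ^ 2) * L ^ 2) hb (by positivity) (by positivity) hL
    (by rw [div_mul_cancel₀ _ hμ.ne']; linarith) (by positivity) (by linarith) hd'.le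
    (by positivity) (by positivity)
    (fun t => integral_nonneg fun ω => sub_nonneg.2 (hdom.iInf_le _))
    (fun t => integral_nonneg fun ω => consensusErr_nonneg _) hη' hu'
    (fun t => (hfresh t).integral_globalObj_zoStep_le hn hd hds hL hsmooth hbdd hdom (hη0 t).le
      (hu0 t))
    (fun t => (hfresh t).integral_consensusErr_zoStep_le hn hd hds hρ2 hL hsmooth hbdd (hη0 t)
      (hu0 t)) rfl
  refine ⟨⟨fun t => (hfresh t).integrable hδc, ?_⟩,
    ⟨fun t i => (hfresh t).integrable (hdist i), ?_⟩⟩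
  · have hev : ∀ ε > 0, ∀ᶠ t : ℕ in atTop,
        δ t ≤ ((32 * αη ^ 2 * L ^ 2 * optGap f / μ ^ 2 +
          6 * αη * αu ^ 2 * L ^ 2 / μ) * d + ε) * (1 / (t : ℝ)) := by
      intro ε hε
      filter_upwards [hrate₁ ε hε, eventually_gt_atTop 0] with t ht htpos
      have htp : (0 : ℝ) < t := by exact_mod_cast htpos
      have hc : 1 ≤ 2 * αη / μ * μ - 1 := by rw [div_mul_cancel₀ _ hμ.ne']; linarith
      have h1 : (8 / 3 * L ^ 2 * d * (2 * αη / μ) ^ 2 * optGap f +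
          2 * αη / μ * d * L ^ 2 * αu ^ 2 / 4) / (2 * αη / μ * μ - 1) ≤
          (32 * αη ^ 2 * L ^ 2 * optGap f / μ ^ 2 + 6 * αη * αu ^ 2 * L ^ 2 / μ) * d := by
        refine (div_le_self (by positivity) hc).trans ?_
        have e : 8 / 3 * L ^ 2 * d * (2 * αη / μ) ^ 2 * optGap f +
            2 * αη / μ * d * L ^ 2 * αu ^ 2 / 4 =
            1 / 3 * (32 * αη ^ 2 * L ^ 2 * optGap f / μ ^ 2 * d) +
              1 / 12 * (6 * αη * αu ^ 2 * L ^ 2 / μ * d) := by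
          field_simp; ring
        have e1 : 0 ≤ 32 * αη ^ 2 * L ^ 2 * optGap f / μ ^ 2 * d := by positivity
        have e2 : 0 ≤ 6 * αη * αu ^ 2 * L ^ 2 / μ * d := by positivity
        rw [e]
        linarith
      have h2 : δ t ≤ ((32 * αη ^ 2 * L ^ 2 * optGap f / μ ^ 2 +
          6 * αη * αu ^ 2 * L ^ 2 / μ) * d + ε) / (t + (1 + t0)) :=
        (le_div_iff₀ (hs t)).2 (by linarith)
      rw [mul_one_div]
      refine h2.trans ?_
      gcongr
      linarith
    obtain ⟨r, hr, hle⟩ := exists_isLittleO_remainder (Eventually.of_forall fun t => by positivity)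
      hev
    refine ⟨r, hr, fun t _ => ?_⟩
    have := hle t
    rwa [mul_one_div, mul_div_assoc] at this
  · have hsum : ∀ t, (1 / (n : ℝ)) * ∑ i, ∫ ω, ‖X t ω i - agentAvg (X t ω)‖ ^ 2 ∂P = v t := by
      intro t
      simp only [hv, consensusErr]
      rw [integral_const_mul, integral_finsetSum _ fun i _ => (hfresh t).integrable (hdist i)]
    simp only [hsum]
    have hev : ∀ ε > 0, ∀ᶠ t : ℕ in atTop,
        v t ≤ (32 * αη ^ 2 * ρ ^ 2 * L * optGap f / (μ ^ 2 * (1 - ρ ^ 2))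
          * (4 * d / 3 + 6 * ρ ^ 2 / (1 - ρ ^ 2)) + ε) * (1 / (t : ℝ) ^ 2) := by
      intro ε hε
      filter_upwards [hrate₂ ε hε, eventually_gt_atTop 0] with t ht htpos
      have htp : (0 : ℝ) < t := by exact_mod_cast htpos
      have h1 : 4 * L * optGap f * (4 / 3 * ρ ^ 2 * d + 4 * ρ ^ 4 / (1 - ρ ^ 2)) *
          (2 * αη / μ) ^ 2 / (1 - (1 + ρ ^ 2) / 2) ≤
          32 * αη ^ 2 * ρ ^ 2 * L * optGap f / (μ ^ 2 * (1 - ρ ^ 2))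
                * (4 * d / 3 + 6 * ρ ^ 2 / (1 - ρ ^ 2)) := by
        have e : 4 * L * optGap f * (4 / 3 * ρ ^ 2 * d + 4 * ρ ^ 4 / (1 - ρ ^ 2)) *
            (2 * αη / μ) ^ 2 / (1 - (1 + ρ ^ 2) / 2) =
            32 * αη ^ 2 * ρ ^ 2 * L * optGap f / (μ ^ 2 * (1 - ρ ^ 2))
                * (4 * d / 3 + 4 * ρ ^ 2 / (1 - ρ ^ 2)) := by
          rw [show 1 - (1 + ρ ^ 2) / 2 = (1 - ρ ^ 2) / 2 by ring]
          field_simp; ring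
        rw [e]
        gcongr
        norm_num
      have h2 : v t ≤ (32 * αη ^ 2 * ρ ^ 2 * L * optGap f / (μ ^ 2 * (1 - ρ ^ 2))
                * (4 * d / 3 + 6 * ρ ^ 2 / (1 - ρ ^ 2)) + ε) / (t + (1 + t0)) ^ 2 := by
        have := hs t
        exact (le_div_iff₀ (by positivity)).2 (by linarith)
      rw [mul_one_div]
      refine h2.trans ?_
      gcongr
      linarith
    obtain ⟨r, hr, hle⟩ := exists_isLittleO_remainder (Eventually.of_forall fun t => by positivity)
      hev
    exact ⟨r, hr, fun t _ => hle t⟩
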